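/- **Setting.** Let $x=(x^1,\dots,x^n)$ be the independent variables. For dependent variables $u=(u^\alpha)$, write $u^\alpha_I$ for the jet variable representing the derivative of $u^\alpha$ of multi-index $I$ (so $u^\alpha_0=u^\alpha$). A differential function over an open set $U\subseteq\mathbb R^n$ is a real-analytic function of $x\in U$ and of finitely many jet variables. Let $D_i$ be the total differentiation with respect to $x^i$ and $D^I=D_1^{I_1}\cdots D_n^{I_n}$. The adjoint equations to a system $F_\beta(x,u,u_{(1)},\dots,u_{(s)})=0$ are $$F^*_\alpha(x,u,v,u_{(1)},v_{(1)},\dots):=\frac{\delta\big(\sum_\beta v^\beta F_\beta\big)}{\delta u^\alpha}=0,\qquad \frac{\delta}{\delta u^\alpha}=\sum_I(-1)^{|I|}D^I\frac{\partial}{\partial u^\alpha_I},$$ where the $v^\beta$ are new dependent variables. Let $U\subseteq\mathbb R^n$ be open and connected, and let $\varphi=(\varphi^\beta(x,u))$ be real-analytic for $x\in U$ and all values of $u$, and not identically zero. The system is *nonlinearly self-adjoint over $U$ via $v=\varphi(x,u)$* 1. *by the first definition*, if there are differential functions $\lambda_\alpha^\beta$ over $U$ such that $F^*_\alpha\big|_{v^\beta_I=D^I(\varphi^\beta(x,u))}=\sum_\beta\lambda_\alpha^\beta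 F_\beta$ identically in $x\in U$ and in all jet variables of $u$; 2. *by the second definition*, if for every open $V\subseteq U$ and every smooth solution $u(x)$ of the system on $V$, the functions $v^\beta(x)=\varphi^\beta(x,u(x))$ satisfy the adjoint equations on $V$. **Proposition.** Any linear differential equation with one dependent variable is (locally) nonlinearly self-adjoint. Precisely, let $\Omega\subseteq\mathbb R^n$ be open, let $a_I$ ($|I|\le s$) and $f$ be real-analytic on $\Omega$, where some $a_I$ with $|I|=s$ is not identically zero on $\Omega$, and let $$F[u]=\sum_{|I|\le s}a_I(x)\,u_I+f(x).$$ Then: * **(a)** For $x\in\Omega$, the adjoint equation $F^*=0$ does not involve $u$ or its derivatives. * **(b)** If $U\subseteq\Omega$ is open and connected and $\psi$ is a real-analytic function on $U$, not identically zero, with $F^*[\psi]=0$ on $U$, then $F[u]=0$ is nonlinearly self-adjoint over $U$ via $v=\psi(x)$, by both definitions. * **(c)** For every $x_0\in\Omega$ at which $a_I(x_0)\ne0$ for some $|I|=s$, there are an open connected set $U$ with $x_0\in U\subseteq\Omega$ and a function $\varphi$ such that $F[u]=0$ is nonlinearly self-adjoint over $U$ via $v=\varphi(x,u)$, by both definitions.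 If $s\ge1$, one can take $\varphi(x,u)=\psi(x)$ independent of $u$ and nowhere zero on $U$. -/

import Mathlib

open scoped ContDiff

/-- A point of the infinite jet space over `ℝⁿ` with dependent variables indexed by `κ`:
the independent variables `x = (x¹, …, xⁿ)`, and for each dependent variable `k` and each
multi-index `I` the coordinate `u^k_I` standing for the derivative of `u^k` of multi-index `I`
(`I = 0` gives `u^k` itself). -/
abbrev Jet (n : ℕ) (κ : Type*) : Type _ :=
  (Fin n → ℝ) × (κ × (Fin n →₀ ℕ) → ℝ)

/-- Differential functions over `U`: real analytic functions of `x ∈ U` and of finitely many of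
the jet variables. -/
def IsDifferentialFunctionOn {n : ℕ} {κ : Type*} (U : Set (Fin n → ℝ))
    (G : Jet n κ → ℝ) : Prop :=
  ∃ (S : Finset (κ × (Fin n →₀ ℕ))) (g : (Fin n → ℝ) × (S → ℝ) → ℝ),
    AnalyticOnNhd ℝ g (U ×ˢ Set.univ) ∧
      ∀ z : Jet n κ, z.1 ∈ U → G z = g (z.1, fun p => z.2 p)

/-- The partial derivative `∂G/∂xⁱ` of a function on the jet space (jet variables fixed). -/
noncomputable def partialX {n : ℕ} {κ : Type*} (i : Fin n) (G : Jet n κ → ℝ) : Jet n κ → ℝ :=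
  fun z => deriv (fun t => G (Function.update z.1 i t, z.2)) (z.1 i)

/-- The partial derivative `∂G/∂u^k_I` of a function on the jet space, where `p = (k, I)`. -/
noncomputable def partialJ {n : ℕ} {κ : Type*} [DecidableEq κ] (p : κ × (Fin n →₀ ℕ))
    (G : Jet n κ → ℝ) : Jet n κ → ℝ :=
  fun z => deriv (fun t => G (z.1, Function.update z.2 p t)) (z.2 p)

/-- Total differentiation `D_i = ∂/∂xⁱ + ∑_{k, I} u^k_{I + e_i} ∂/∂u^k_I`. The sum has finitely
many nonzero terms for functions of finitely many variables. -/
noncomputable def totalD {n : ℕ} {κ : Type*} [DecidableEq κ] (i : Fin n)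
    (G : Jet n κ → ℝ) : Jet n κ → ℝ :=
  fun z => partialX i G z +
    ∑ᶠ p : κ × (Fin n →₀ ℕ), z.2 (p.1, p.2 + Finsupp.single i 1) * partialJ p G z

/-- For operators `D_1, …, D_n`, the composition `D_1^{I_1} ⋯ D_n^{I_n}`. -/
def multiIter {n : ℕ} {X : Type*} (D : Fin n → X → X) (I : Fin n →₀ ℕ) (G : X) : X :=
  (List.finRange n).foldr (fun i H => (D i)^[I i] H) G

/-- The Euler-Lagrange operator `δ/δu^k = ∑_I (-1)^{|I|} D^I ∂/∂u^k_I`. -/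
noncomputable def eulerLagrange {n : ℕ} {κ : Type*} [DecidableEq κ] (k : κ)
    (L : Jet n κ → ℝ) : Jet n κ → ℝ :=
  fun z => ∑ᶠ I : Fin n →₀ ℕ, (-1 : ℝ) ^ I.degree * multiIter totalD I (partialJ (k, I) L) z

/-- The formal Lagrangian `∑_β v^β F_β` of a system `F_β(x, u, u_(1), …) = 0`, a function on the
jet space with dependent variables `u` (`Sum.inl`) and `v` (`Sum.inr`). -/
noncomputable def formalLagrangian {n : ℕ} {A B : Type*} [Fintype B]
    (F : B → Jet n A → ℝ) : Jet n (A ⊕ B) → ℝ :=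
  fun z => ∑ β, z.2 (Sum.inr β, 0) * F β (z.1, fun p => z.2 (Sum.inl p.1, p.2))

/-- The left-hand sides `F*_α = δ(∑_β v^β F_β)/δu^α` of the adjoint equations. -/
noncomputable def adjointSystem {n : ℕ} {A B : Type*} [DecidableEq A] [DecidableEq B] [Fintype B]
    (F : B → Jet n A → ℝ) (α : A) : Jet n (A ⊕ B) → ℝ :=
  eulerLagrange (Sum.inl α) (formalLagrangian F)

/-- The partial derivative `∂f/∂xⁱ` of a function on `ℝⁿ`. -/
noncomputable def pderivX {n : ℕ} (i : Fin n) (f : (Fin n → ℝ) → ℝ) : (Fin n → ℝ) → ℝ :=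
  fun x => deriv (fun t => f (Function.update x i t)) (x i)

/-- The infinite jet at `x` of a tuple of functions on `ℝⁿ`: all their partial derivatives. -/
noncomputable def jetOf {n : ℕ} {κ : Type*} (w : κ → (Fin n → ℝ) → ℝ) (x : Fin n → ℝ) :
    Jet n κ :=
  (x, fun p => multiIter pderivX p.2 (w p.1) x)

/-- `u` is a (smooth) solution on `V` of the system `F_β(x, u, u_(1), …) = 0`. -/
def IsSolutionOn {n : ℕ} {A B : Type*} (V : Set (Fin n → ℝ)) (F : B → Jet n A → ℝ)
    (u : A → (Fin n → ℝ) → ℝ) : Prop :=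
  (∀ α, ContDiffOn ℝ ∞ (u α) V) ∧ ∀ x ∈ V, ∀ β, F β (jetOf u x) = 0

/-- A point-wise substitution `v^β = φ^β(x, u)`, analytic for `x` in the domain `U` and not
identically zero. -/
def IsSubstitutionOn {n : ℕ} {A B : Type*} [Fintype A] (U : Set (Fin n → ℝ))
    (φ : B → (Fin n → ℝ) × (A → ℝ) → ℝ) : Prop :=
  IsOpen U ∧ IsConnected U ∧ (∀ β, AnalyticOnNhd ℝ (φ β) (U ×ˢ Set.univ)) ∧
    ∃ p ∈ U ×ˢ (Set.univ : Set (A → ℝ)), ∃ β, φ β p ≠ 0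

/-- `φ^β(x, u)` regarded as a function on the jet space of `u`. -/
def substOnJets {n : ℕ} {A B : Type*} (φ : B → (Fin n → ℝ) × (A → ℝ) → ℝ) (β : B) :
    Jet n A → ℝ :=
  fun z => φ β (z.1, fun α => z.2 (α, 0))

/-- Replacing in a jet `(x, u, v)` the coordinates `v^β_I` by the total derivatives
`D^I (φ^β(x, u))`. -/
noncomputable def substituteJet {n : ℕ} {A B : Type*} [DecidableEq A]
    (φ : B → (Fin n → ℝ) × (A → ℝ) → ℝ) (z : Jet n A) : Jet n (A ⊕ B) :=
  (z.1, fun p => match p with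
    | (Sum.inl α, I) => z.2 (α, I)
    | (Sum.inr β, I) => multiIter totalD I (substOnJets φ β) z)

/-- Nonlinear self-adjointness over `U` through the substitution `v = φ(x, u)`, first definition:
the identities `F*_α(x, u, φ, …, φ_(s)) = ∑_β λ^β_α F_β(x, u, …, u_(s))` hold on the jet space,
with some differential functions `λ^β_α` as coefficients. -/
def IsNonlinearlySelfAdjointVia {n : ℕ} {A B : Type*} [Fintype A] [DecidableEq A] [Fintype B]
    [DecidableEq B] (U : Set (Fin n → ℝ)) (F : B → Jet n A → ℝ)
    (φ : B → (Fin n → ℝ) × (A → ℝ) → ℝ) : Prop :=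
  IsSubstitutionOn U φ ∧
    ∃ lam : A → B → Jet n A → ℝ, (∀ α β, IsDifferentialFunctionOn U (lam α β)) ∧
      ∀ z : Jet n A, z.1 ∈ U → ∀ α,
        adjointSystem F α (substituteJet φ z) = ∑ β, lam α β z * F β z

/-- Nonlinear self-adjointness over `U` through the substitution `v = φ(x, u)`, second definition:
for every solution `u(x)` of the system (on any open part of `U`), `v(x) = φ(x, u(x))` solves the
adjoint system. -/
def IsNonlinearlySelfAdjointViaSolutions {n : ℕ} {A B : Type*} [Fintype A] [DecidableEq A]
    [Fintype B] [DecidableEq B] (U : Set (Fin n → ℝ)) (F : B → Jet n A → ℝ)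
    (φ : B → (Fin n → ℝ) × (A → ℝ) → ℝ) : Prop :=
  IsSubstitutionOn U φ ∧
    ∀ V : Set (Fin n → ℝ), IsOpen V → V ⊆ U → ∀ u : A → (Fin n → ℝ) → ℝ, IsSolutionOn V F u →
      ∀ x ∈ V, ∀ α,
        adjointSystem F α (jetOf (Sum.elim u fun β y => φ β (y, fun a => u a y)) x) = 0

/-- The left-hand side `F[u] = ∑_{|I| ≤ s} a_I(x) u_I + f(x)` of a linear differential equation
with one dependent variable, as a system of one equation. -/
noncomputable def linearEquation {n : ℕ} (s : ℕ) (a : (Fin n →₀ ℕ) → (Fin n → ℝ) → ℝ)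
    (f : (Fin n → ℝ) → ℝ) : Unit → Jet n Unit → ℝ :=
  fun _ z => (∑ I ∈ (Finsupp.finite_of_degree_le (σ := Fin n) s).toFinset,
    a I z.1 * z.2 ((), I)) + f z.1

/-! The formal Lagrangian is `v F[u]` with `F` affine in `u`, so `F*[v] = ∑ (-1)^|I| D^I (a_I v)` is
linear in `v`, free of `u`, and has the coefficients `(-1)^s a_K` in order `s`
(`exists_adjointSystem_linearEquation_eq_sum`). Hence every solution `ψ(x)` of `F* = 0` that is not
identically zero is an admissible substitution, with `λ = 0`. If `s = 0`, then `F* = a_0 v` and `v =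
F[u]` itself works, with `λ = a_0`.

For `s ≥ 1` it remains to solve a homogeneous linear analytic equation `∑ c_K ∂^K ψ = 0` near `x₀`
with `ψ(x₀) ≠ 0` (`exists_analytic_solution_ne_zero`). No change of coordinates is made. Among the
`K` of degree `s` with `c_K(x₀) ≠ 0`, let `J` maximize `∑ K_i²`; then `J·I < J·J` for every other
such `I`. Let `β_I` be the power series of `c_I / c_J`, and seek `ψ = 1 + ∂^{-J} Y`, where `∂^{-J}`
is the antiderivative divisible by `X^J`. The equation becomes `Y = -β_0 - ∑ β_I ∂^I ∂^{-J} Y`.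

In the `ℓ¹` norm with weights `y^K K!/|K|!`, which is submultiplicative, `∂^I ∂^{-J}` has norm at
most `y^J / y^I` when `|I| ≤ |J|`. For `y_i = R ρ^{J_i}` this ratio is `R^{|J|-|I|} ρ^{J·J - J·I}`.
Choosing `ρ` and then `R` small gives a contraction (`exists_polyradius`), and a Neumann series
yields `Y` (`exists_eq_add_of_contraction`). Finiteness of the norm gives convergence, and `ψ(x₀) =
1` because `J ≠ 0`. -/

/-! ### Iterated operators and multi-indices. -/

theorem multiIter_induction {n : ℕ} {X : Type*} {D : Fin n → X → X} {G : X}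
    (motive : (Fin n →₀ ℕ) → X → Prop) (zero : motive 0 G)
    (step : ∀ i A H, motive A H → motive (A + Finsupp.single i 1) (D i H)) (I : Fin n →₀ ℕ) :
    motive I (multiIter D I G) := by
  have hpow : ∀ (i : Fin n) (m : ℕ) A H, motive A H →
      motive (A + Finsupp.single i m) ((D i)^[m] H) := by
    intro i m
    induction m with
    | zero => intro A H h; simpa using h
    | succ m ih =>
      intro A H h
      rw [Function.iterate_succ_apply', Finsupp.single_add, ← add_assoc]
      exact step _ _ _ (ih A H h)
  have hlist : ∀ l : List (Fin n), motive (l.map fun i => Finsupp.single i (I i)).sum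
      (l.foldr (fun i H => (D i)^[I i] H) G) := by
    intro l
    induction l with
    | nil => simpa using zero
    | cons i l ih =>
      rw [List.map_cons, List.sum_cons, add_comm, List.foldr_cons]
      exact hpow _ _ _ _ ih
  have hI : ((List.finRange n).map fun i => Finsupp.single i (I i)).sum = I := by
    rw [← List.ofFn_eq_map, List.sum_ofFn]
    ext j
    simp
  have := hlist (List.finRange n)
  rwa [hI] at this

theorem multiIter_zero {n : ℕ} {X : Type*} (D : Fin n → X → X) (G : X) : multiIter D 0 G = G :=
  multiIter_induction (fun A H => A = 0 → H = G) (fun _ => rfl)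
    (fun i A H _ h => absurd (congrArg (· i) h) (by simp)) 0 rfl

/-- The multi-indices of degree at most `m`. -/
noncomputable def multiIndicesLE (n m : ℕ) : Finset (Fin n →₀ ℕ) :=
  (Finsupp.finite_of_degree_le (σ := Fin n) m).toFinset

@[simp]
theorem mem_multiIndicesLE {n m : ℕ} {K : Fin n →₀ ℕ} :
    K ∈ multiIndicesLE n m ↔ K.degree ≤ m := by
  simp [multiIndicesLE]

/-! ### Partial derivatives on `ℝⁿ`. -/

section pderivX

variable {n : ℕ}

theorem hasDerivAt_comp_update {g : (Fin n → ℝ) → ℝ} {x : Fin n → ℝ} (i : Fin n)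
    (hg : DifferentiableAt ℝ g x) :
    HasDerivAt (fun t => g (Function.update x i t)) (fderiv ℝ g x (Pi.single i 1)) (x i) := by
  have hg' : HasFDerivAt g (fderiv ℝ g x) (Function.update x i (x i)) := by
    simpa using hg.hasFDerivAt
  exact hg'.comp_hasDerivAt (x i) (hasDerivAt_update x i (x i))

theorem pderivX_eq_fderiv {g : (Fin n → ℝ) → ℝ} {x : Fin n → ℝ} (i : Fin n)
    (hg : DifferentiableAt ℝ g x) : pderivX i g x = fderiv ℝ g x (Pi.single i 1) :=
  (hasDerivAt_comp_update i hg).deriv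

theorem hasDerivAt_pderivX {g : (Fin n → ℝ) → ℝ} {x : Fin n → ℝ} (i : Fin n)
    (hg : DifferentiableAt ℝ g x) :
    HasDerivAt (fun t => g (Function.update x i t)) (pderivX i g x) (x i) := by
  rw [pderivX_eq_fderiv i hg]
  exact hasDerivAt_comp_update i hg

theorem AnalyticOnNhd.pderivX {g : (Fin n → ℝ) → ℝ} {Ω : Set (Fin n → ℝ)} (hΩ : IsOpen Ω)
    (i : Fin n) (hg : AnalyticOnNhd ℝ g Ω) : AnalyticOnNhd ℝ (pderivX i g) Ω := by
  have h := (ContinuousLinearMap.apply ℝ ℝ (Pi.single i (1 : ℝ) : Fin n → ℝ)).comp_analyticOnNhd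
    hg.fderiv
  refine h.congr hΩ fun x hx => ?_
  exact (pderivX_eq_fderiv i (hg x hx).differentiableAt).symm

@[simp]
theorem pderivX_zero (i : Fin n) : pderivX i (0 : (Fin n → ℝ) → ℝ) = 0 := by
  ext x
  simp [pderivX]

end pderivX

/-! ### Total derivatives of functions of `x` and of linear forms in the jet variables. -/

section totalD

variable {n : ℕ} {κ : Type*} [DecidableEq κ]

theorem partialJ_comp_fst (g : (Fin n → ℝ) → ℝ) (p : κ × (Fin n →₀ ℕ)) :
    partialJ p (fun z : Jet n κ => g z.1) = 0 := by
  ext z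
  simp [partialJ]

theorem totalD_comp_fst (g : (Fin n → ℝ) → ℝ) (i : Fin n) :
    totalD i (fun z : Jet n κ => g z.1) = fun z => pderivX i g z.1 := by
  ext z
  simp [totalD, partialJ_comp_fst, partialX, pderivX]

theorem multiIter_totalD_comp_fst (g : (Fin n → ℝ) → ℝ) (I : Fin n →₀ ℕ) :
    multiIter totalD I (fun z : Jet n κ => g z.1) = fun z => multiIter pderivX I g z.1 := by
  have key : ∀ l : List (Fin n), l.foldr (fun i H => (totalD i)^[I i] H)
      (fun z : Jet n κ => g z.1) =
      fun z => l.foldr (fun i H => (pderivX i)^[I i] H) g z.1 := by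
    intro l
    induction l with
    | nil => rfl
    | cons i l ih =>
      rw [List.foldr_cons, List.foldr_cons, ih]
      generalize l.foldr (fun i H => (pderivX i)^[I i] H) g = h
      induction I i with
      | zero => rfl
      | succ m ihm =>
        rw [Function.iterate_succ_apply', ihm, totalD_comp_fst, Function.iterate_succ_apply']
  exact key _

theorem multiIter_totalD_zero (I : Fin n →₀ ℕ) :
    multiIter totalD I (0 : Jet n κ → ℝ) = 0 := by
  refine multiIter_induction (fun _ H => H = 0) rfl (fun i A H hH => ?_) I
  subst hH
  ext z
  simp [totalD, partialX, partialJ]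

/-- Over `Ω`, the function `G` is a linear combination of the jet variables `w^k_K` with
`|K| ≤ m`, the coefficients `c K` being analytic functions of `x`. -/
structure IsLinearFormOn (Ω : Set (Fin n → ℝ)) (k : κ) (m : ℕ)
    (c : (Fin n →₀ ℕ) → (Fin n → ℝ) → ℝ) (G : Jet n κ → ℝ) : Prop where
  analytic : ∀ K, AnalyticOnNhd ℝ (c K) Ω
  eq_zero : ∀ K, m < K.degree → c K = 0
  eq_sum : ∀ x ∈ Ω, ∀ w, G (x, w) = ∑ K ∈ multiIndicesLE n m, c K x * w (k, K)

/-- The coefficients of the total derivative of a linear form. -/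
noncomputable def totalDCoeff (i : Fin n) (c : (Fin n →₀ ℕ) → (Fin n → ℝ) → ℝ)
    (K : Fin n →₀ ℕ) : (Fin n → ℝ) → ℝ :=
  pderivX i (c K) + if 0 < K i then c (K - Finsupp.single i 1) else 0

theorem sub_single_add_single {K : Fin n →₀ ℕ} {i : Fin n} (h : 0 < K i) :
    K - Finsupp.single i 1 + Finsupp.single i 1 = K :=
  tsub_add_cancel_of_le (by simpa [Finsupp.single_le_iff] using Nat.one_le_of_lt h)

/-- `D_i (c w_K) = (∂_i c) w_K + c w_{K + e_i}`. The guard `0 < K i` in `totalDCoeff` is needed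
because truncated subtraction would otherwise return `c K` itself. -/
theorem IsLinearFormOn.totalD {Ω : Set (Fin n → ℝ)} (hΩ : IsOpen Ω) {k : κ} {m : ℕ}
    {c : (Fin n →₀ ℕ) → (Fin n → ℝ) → ℝ} {G : Jet n κ → ℝ} (hG : IsLinearFormOn Ω k m c G)
    (i : Fin n) : IsLinearFormOn Ω k (m + 1) (totalDCoeff i c) (totalD i G) where
  analytic K := by
    unfold totalDCoeff
    refine ((hG.analytic K).pderivX hΩ i).add ?_
    split_ifs
    · exact hG.analytic _
    · exact analyticOnNhd_const
  eq_zero K hK := by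
    unfold totalDCoeff
    rw [hG.eq_zero K (by omega), pderivX_zero, zero_add]
    split_ifs with h
    · apply hG.eq_zero
      have := congrArg Finsupp.degree (sub_single_add_single h)
      simp only [map_add, Finsupp.degree_single] at this
      omega
    · rfl
  eq_sum x hx w := by
    have hX : partialX i G (x, w) =
        ∑ K ∈ multiIndicesLE n m, pderivX i (c K) x * w (k, K) := by
      refine HasDerivAt.deriv (f := fun t => G (Function.update x i t, w)) ?_
      have h1 : HasDerivAt (fun t => ∑ K ∈ multiIndicesLE n m,
          c K (Function.update x i t) * w (k, K))
          (∑ K ∈ multiIndicesLE n m, pderivX i (c K) x * w (k, K)) (x i) :=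
        HasDerivAt.fun_sum fun K _ =>
          (hasDerivAt_pderivX i (hG.analytic K x hx).differentiableAt).mul_const _
      refine h1.congr_of_eventuallyEq ?_
      have hmem : ∀ᶠ t in nhds (x i), Function.update x i t ∈ Ω :=
        (continuous_const.update i continuous_id).continuousAt.eventually
          (hΩ.mem_nhds (by simpa using hx))
      filter_upwards [hmem] with t ht using hG.eq_sum _ ht w
    have hJ : ∀ p, partialJ p G (x, w) =
        if p.1 = k ∧ p.2 ∈ multiIndicesLE n m then c p.2 x else 0 := by
      rintro ⟨l, L⟩
      refine HasDerivAt.deriv (f := fun t => G (x, Function.update w (l, L) t)) ?_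
      have h1 : HasDerivAt (fun t => ∑ K ∈ multiIndicesLE n m,
          c K x * Function.update w (l, L) t (k, K))
          (∑ K ∈ multiIndicesLE n m, c K x * if (k, K) = (l, L) then 1 else 0) (w (l, L)) := by
        refine HasDerivAt.fun_sum fun K _ => HasDerivAt.const_mul _ ?_
        split_ifs with h
        · rw [← h]
          simpa using hasDerivAt_id' (w (k, K))
        · simpa [Function.update_of_ne h] using hasDerivAt_const (w (l, L)) (w (k, K))
      have h2 : (∑ K ∈ multiIndicesLE n m, c K x * if (k, K) = (l, L) then 1 else 0) =
          if l = k ∧ L ∈ multiIndicesLE n m then c L x else 0 := by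
        by_cases hl : l = k
        · subst hl
          simp
        · simp [hl, Ne.symm hl]
      rw [h2] at h1
      refine h1.congr_of_eventuallyEq (Filter.Eventually.of_forall fun t => ?_)
      exact hG.eq_sum _ hx _
    have hsum : ∑ᶠ p : κ × (Fin n →₀ ℕ), w (p.1, p.2 + Finsupp.single i 1) * partialJ p G (x, w) =
        ∑ K ∈ multiIndicesLE n m, c K x * w (k, K + Finsupp.single i 1) := by
      rw [finsum_eq_sum_of_support_subset (s := (multiIndicesLE n m).map
        ⟨fun K => (k, K), fun _ _ h => (Prod.ext_iff.1 h).2⟩)]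
      · rw [Finset.sum_map]
        refine Finset.sum_congr rfl fun K hK => ?_
        rw [hJ, if_pos ⟨rfl, hK⟩]
        exact mul_comm _ _
      · rintro ⟨l, L⟩ hp
        rw [Function.mem_support, hJ] at hp
        have : l = k ∧ L ∈ multiIndicesLE n m := by
          by_contra h
          exact hp (by rw [if_neg h, mul_zero])
        obtain ⟨rfl, hL⟩ := this
        exact Finset.mem_coe.2 (Finset.mem_map_of_mem _ hL)
    change partialX i G (x, w) + ∑ᶠ p : κ × (Fin n →₀ ℕ),
      w (p.1, p.2 + Finsupp.single i 1) * partialJ p G (x, w) = _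
    rw [hX, hsum]
    simp only [totalDCoeff, Pi.add_apply, add_mul, Finset.sum_add_distrib]
    congr 1
    · refine Finset.sum_subset (fun K => by simp only [mem_multiIndicesLE]; omega) ?_
      intro K _ hK
      rw [hG.eq_zero K (by simpa using hK)]
      simp
    · have hinj : Function.Injective fun K : Fin n →₀ ℕ => K + Finsupp.single i 1 :=
        fun _ _ h => add_right_cancel h
      have : ∑ K ∈ multiIndicesLE n m, c K x * w (k, K + Finsupp.single i 1) =
          ∑ K ∈ (multiIndicesLE n m).map ⟨_, hinj⟩,
            (if 0 < K i then c (K - Finsupp.single i 1) else 0) x * w (k, K) := by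
        simp [Finset.sum_map]
      rw [this]
      refine Finset.sum_subset (fun K hK => ?_) fun K hK hK' => ?_
      · obtain ⟨L, hL, rfl⟩ := Finset.mem_map.1 hK
        simpa using hL
      · rw [if_neg, Pi.zero_apply, zero_mul]
        intro h
        refine hK' (Finset.mem_map.2 ⟨K - Finsupp.single i 1, ?_, sub_single_add_single h⟩)
        have := congrArg Finsupp.degree (sub_single_add_single h)
        simp only [map_add, Finsupp.degree_single] at this
        rw [mem_multiIndicesLE] at hK ⊢
        omega

/-- By the Leibniz rule, full order is reached only when every derivative falls on the jet variable.
The second clause records this; it shows later that the adjoint keeps the order of the equation at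
`x₀`. -/
theorem exists_isLinearFormOn_multiIter_totalD {Ω : Set (Fin n → ℝ)} (hΩ : IsOpen Ω) (k : κ)
    {a : (Fin n → ℝ) → ℝ} (ha : AnalyticOnNhd ℝ a Ω) (I : Fin n →₀ ℕ) :
    ∃ c, IsLinearFormOn Ω k I.degree c (multiIter totalD I fun z => z.2 (k, 0) * a z.1) ∧
      ∀ K, K.degree = I.degree → c K = if K = I then a else 0 := by
  refine multiIter_induction (fun A H => ∃ c, IsLinearFormOn Ω k A.degree c H ∧
      ∀ K, K.degree = A.degree → c K = if K = A then a else 0) ?_ ?_ I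
  · refine ⟨fun K => if K = 0 then a else 0, ⟨fun K => ?_, fun K hK => ?_, ?_⟩, fun K _ => rfl⟩
    · split_ifs
      · exact ha
      · exact analyticOnNhd_const
    · rw [if_neg]
      rintro rfl
      simp at hK
    · intro x _ w
      rw [Finset.sum_eq_single 0]
      · simp [mul_comm]
      · intro K _ hK
        simp [hK]
      · simp
  · rintro i A H ⟨c, hc, htop⟩
    refine ⟨totalDCoeff i c, ?_, fun K hK => ?_⟩
    · simpa using hc.totalD hΩ i
    · simp only [map_add, Finsupp.degree_single] at hK
      rw [totalDCoeff, hc.eq_zero K (by omega), pderivX_zero, zero_add]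
      by_cases h : 0 < K i
      · have h1 := sub_single_add_single h
        have h2 := congrArg Finsupp.degree h1
        simp only [map_add, Finsupp.degree_single] at h2
        rw [if_pos h, htop _ (by omega)]
        refine if_congr ⟨fun h3 => ?_, fun h3 => ?_⟩ rfl rfl
        · rw [← h1, h3]
        · rw [h3, add_tsub_cancel_right]
      · rw [if_neg h, if_neg]
        rintro rfl
        simp at h

end totalD

/-! ### The adjoint of a linear equation and the substitutions it admits. -/

section adjoint

variable {n : ℕ}

theorem partialJ_formalLagrangian_linearEquation (s : ℕ)
    (a : (Fin n →₀ ℕ) → (Fin n → ℝ) → ℝ) (f : (Fin n → ℝ) → ℝ) (I : Fin n →₀ ℕ) :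
    partialJ (Sum.inl (), I) (formalLagrangian (linearEquation s a f)) =
      if I.degree ≤ s then fun z : Jet n (Unit ⊕ Unit) => z.2 (Sum.inr (), 0) * a I z.1
      else 0 := by
  ext ⟨x, w⟩
  have h1 : HasDerivAt (fun t => formalLagrangian (linearEquation s a f)
      (x, Function.update w (Sum.inl (), I) t))
      (w (Sum.inr (), 0) * (∑ K ∈ multiIndicesLE n s, a K x * if K = I then 1 else 0))
      (w (Sum.inl (), I)) := by
    simp only [formalLagrangian, linearEquation, Finset.univ_unique, Finset.sum_singleton]
    have h0 : ∀ t, Function.update w (Sum.inl (), I) t (Sum.inr default, 0) =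
        w (Sum.inr (), 0) := fun t => Function.update_of_ne (by simp) _ _
    simp only [h0]
    refine HasDerivAt.const_mul _ (HasDerivAt.add_const _ (HasDerivAt.fun_sum fun K _ =>
      HasDerivAt.const_mul _ ?_))
    split_ifs with h
    · subst h
      simpa using hasDerivAt_id' (w (Sum.inl (), K))
    · simpa [Function.update_apply, h] using
        hasDerivAt_const (w (Sum.inl (), I)) (w (Sum.inl (), K))
  refine h1.deriv.trans ?_
  split_ifs with h
  · simp [h]
  · simp [h]

/-- The adjoint of a linear equation is linear in the jet variables of `v`, does not involve `u`,
and has up to sign the same coefficients of top order. -/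
theorem exists_adjointSystem_linearEquation_eq_sum (s : ℕ) {Ω : Set (Fin n → ℝ)} (hΩ : IsOpen Ω)
    (a : (Fin n →₀ ℕ) → (Fin n → ℝ) → ℝ) (f : (Fin n → ℝ) → ℝ)
    (ha : ∀ I, I.degree ≤ s → AnalyticOnNhd ℝ (a I) Ω) :
    ∃ c : (Fin n →₀ ℕ) → (Fin n → ℝ) → ℝ, (∀ K, AnalyticOnNhd ℝ (c K) Ω) ∧
      (∀ K, K.degree = s → ∀ x, c K x = (-1) ^ s * a K x) ∧
      ∀ x ∈ Ω, ∀ w, adjointSystem (linearEquation s a f) () (x, w) =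
        ∑ K ∈ multiIndicesLE n s, c K x * w (Sum.inr (), K) := by
  have hex : ∀ I : Fin n →₀ ℕ, ∃ c : (Fin n →₀ ℕ) → (Fin n → ℝ) → ℝ, I.degree ≤ s →
      IsLinearFormOn Ω (Sum.inr () : Unit ⊕ Unit) I.degree c
        (multiIter totalD I fun z => z.2 (Sum.inr (), 0) * a I z.1) ∧
      ∀ K, K.degree = I.degree → c K = if K = I then a I else 0 := by
    intro I
    by_cases h : I.degree ≤ s
    · obtain ⟨c, hc⟩ := exists_isLinearFormOn_multiIter_totalD hΩ
        (Sum.inr () : Unit ⊕ Unit) (ha I h) I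
      exact ⟨c, fun _ => hc⟩
    · exact ⟨0, fun h' => absurd h' h⟩
  choose c hc using hex
  refine ⟨fun K x => ∑ I ∈ multiIndicesLE n s, (-1) ^ I.degree * c I K x, fun K => ?_,
    fun K hK x => ?_, fun x hx w => ?_⟩
  · refine Finset.analyticOnNhd_fun_sum _ fun I hI => ?_
    exact analyticOnNhd_const.mul ((hc I (by simpa using hI)).1.analytic K)
  · dsimp only
    rw [Finset.sum_eq_single K]
    · rw [(hc K hK.le).2 K rfl, if_pos rfl, hK]
    · intro I hI hIK
      have hI' : I.degree ≤ s := by simpa using hI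
      rcases hI'.lt_or_eq with h | h
      · rw [(hc I hI').1.eq_zero K (by omega)]
        simp
      · rw [(hc I hI').2 K (by omega), if_neg (Ne.symm hIK)]
        simp
    · simp [hK.le]
  · have hterm : ∀ I ∈ multiIndicesLE n s,
        (-1 : ℝ) ^ I.degree * multiIter totalD I (partialJ (Sum.inl (), I)
          (formalLagrangian (linearEquation s a f))) (x, w) =
        ∑ K ∈ multiIndicesLE n s, (-1) ^ I.degree * c I K x * w (Sum.inr (), K) := by
      intro I hI
      have hI' : I.degree ≤ s := by simpa using hI
      rw [partialJ_formalLagrangian_linearEquation, if_pos hI', (hc I hI').1.eq_sum x hx,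
        Finset.mul_sum]
      refine (Finset.sum_congr rfl fun K _ => (mul_assoc _ _ _).symm).trans ?_
      refine Finset.sum_subset (fun K => by simp only [mem_multiIndicesLE]; omega) ?_
      intro K _ hK
      rw [(hc I hI').1.eq_zero K (by simpa using hK)]
      simp
    unfold adjointSystem eulerLagrange
    rw [finsum_eq_sum_of_support_subset (s := multiIndicesLE n s), Finset.sum_congr rfl hterm,
      Finset.sum_comm]
    · simp only [Finset.sum_mul]
    -- For `|I| > s` the Lagrangian does not contain `u_I`, so the `finsum` has finite support and
    -- is a genuine sum.
    · intro I hI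
      by_contra h
      have h' : ¬ I.degree ≤ s := by simpa using h
      rw [Function.mem_support, partialJ_formalLagrangian_linearEquation, if_neg h',
        multiIter_totalD_zero] at hI
      simp at hI

theorem adjointSystem_linearEquation_congr (s : ℕ) {Ω : Set (Fin n → ℝ)} (hΩ : IsOpen Ω)
    (a : (Fin n →₀ ℕ) → (Fin n → ℝ) → ℝ) (f : (Fin n → ℝ) → ℝ)
    (ha : ∀ I, I.degree ≤ s → AnalyticOnNhd ℝ (a I) Ω) {x : Fin n → ℝ} (hx : x ∈ Ω)
    {w w' : (Unit ⊕ Unit) × (Fin n →₀ ℕ) → ℝ}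
    (h : ∀ I, w (Sum.inr (), I) = w' (Sum.inr (), I)) :
    adjointSystem (linearEquation s a f) () (x, w) =
      adjointSystem (linearEquation s a f) () (x, w') := by
  obtain ⟨c, -, -, hc⟩ := exists_adjointSystem_linearEquation_eq_sum s hΩ a f ha
  simp only [hc x hx, h]

/-- A nonzero solution `ψ(x)` of the adjoint of a linear equation is an admissible substitution. -/
theorem isNonlinearlySelfAdjoint_of_adjoint_solution (s : ℕ) {Ω : Set (Fin n → ℝ)}
    (hΩ : IsOpen Ω) (a : (Fin n →₀ ℕ) → (Fin n → ℝ) → ℝ) (f : (Fin n → ℝ) → ℝ)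
    (ha : ∀ I, I.degree ≤ s → AnalyticOnNhd ℝ (a I) Ω) {U : Set (Fin n → ℝ)} (hU : IsOpen U)
    (hUc : IsConnected U) (hUΩ : U ⊆ Ω) {ψ : (Fin n → ℝ) → ℝ} (hψ : AnalyticOnNhd ℝ ψ U)
    (hne : ∃ x ∈ U, ψ x ≠ 0)
    (hsol : ∀ x ∈ U, adjointSystem (linearEquation s a f) ()
      (jetOf (Sum.elim (fun _ _ => 0) fun _ => ψ) x) = 0) :
    IsNonlinearlySelfAdjointVia U (linearEquation s a f) (fun _ p => ψ p.1) ∧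
      IsNonlinearlySelfAdjointViaSolutions U (linearEquation s a f) (fun _ p => ψ p.1) := by
  have hsub : IsSubstitutionOn (A := Unit) (B := Unit) U (fun _ p => ψ p.1) := by
    refine ⟨hU, hUc, fun _ => ?_, ?_⟩
    · exact hψ.comp (analyticOnNhd_fst (𝕜 := ℝ)) fun p hp => hp.1
    · obtain ⟨x, hx, hxψ⟩ := hne
      exact ⟨(x, 0), ⟨hx, trivial⟩, (), hxψ⟩
  refine ⟨⟨hsub, fun _ _ _ => 0, fun _ _ => ⟨∅, fun _ => 0, analyticOnNhd_const, fun _ _ => rfl⟩,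
    fun z hz _ => ?_⟩, hsub, fun V _ hVU u _ x hx _ => ?_⟩
  · simp only [zero_mul, Finset.sum_const_zero]
    -- The adjoint sees only the `v`-part of a jet, so the zero `u`-part used in `hsol` may be
    -- replaced by any other.
    rw [← hsol z.1 hz]
    refine adjointSystem_linearEquation_congr s hΩ a f ha (hUΩ hz) fun I => ?_
    change multiIter totalD I (fun z : Jet n Unit => ψ z.1) z = _
    rw [multiIter_totalD_comp_fst]
    rfl
  · rw [← hsol x (hVU hx)]
    exact adjointSystem_linearEquation_congr s hΩ a f ha (hUΩ (hVU hx)) fun I => rfl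

/-- An equation of order zero is nonlinearly self-adjoint through its own left-hand side. -/
theorem isNonlinearlySelfAdjoint_of_order_zero {Ω : Set (Fin n → ℝ)}
    (hΩ : IsOpen Ω) (a : (Fin n →₀ ℕ) → (Fin n → ℝ) → ℝ) (f : (Fin n → ℝ) → ℝ)
    (ha : AnalyticOnNhd ℝ (a 0) Ω) {U : Set (Fin n → ℝ)} (hU : IsOpen U)
    (hUc : IsConnected U) (hUΩ : U ⊆ Ω) (hf : AnalyticOnNhd ℝ f U) (hne : ∃ x ∈ U, a 0 x ≠ 0) :
    IsNonlinearlySelfAdjointVia U (linearEquation 0 a f) (fun _ p => a 0 p.1 * p.2 () + f p.1) ∧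
      IsNonlinearlySelfAdjointViaSolutions U (linearEquation 0 a f)
        (fun _ p => a 0 p.1 * p.2 () + f p.1) := by
  have haU : AnalyticOnNhd ℝ (a 0) U := ha.mono hUΩ
  have ha' : ∀ I : Fin n →₀ ℕ, I.degree ≤ 0 → AnalyticOnNhd ℝ (a I) Ω := by
    intro I hI
    rw [(Finsupp.degree_eq_zero_iff I).1 (by omega)]
    exact ha
  have hmem : multiIndicesLE n 0 = {0} := by
    ext K
    simp [Finsupp.degree_eq_zero_iff]
  have hadj : ∀ x ∈ Ω, ∀ w, adjointSystem (linearEquation 0 a f) () (x, w) =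
      a 0 x * w (Sum.inr (), 0) := by
    obtain ⟨c, -, htop, hc⟩ := exists_adjointSystem_linearEquation_eq_sum 0 hΩ a f ha'
    intro x hx w
    rw [hc x hx, hmem, Finset.sum_singleton, htop 0 (by simp), pow_zero, one_mul]
  have hF : ∀ z : Jet n Unit, linearEquation 0 a f () z = a 0 z.1 * z.2 ((), 0) + f z.1 := by
    intro z
    change ∑ I ∈ multiIndicesLE n 0, _ + _ = _
    rw [hmem, Finset.sum_singleton]
  have hsub : IsSubstitutionOn (A := Unit) (B := Unit) U
      (fun _ p => a 0 p.1 * p.2 () + f p.1) := by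
    refine ⟨hU, hUc, fun _ => ?_, ?_⟩
    · refine AnalyticOnNhd.add (AnalyticOnNhd.mul ?_ ?_) ?_
      · exact haU.comp (analyticOnNhd_fst (𝕜 := ℝ)) fun p hp => hp.1
      · exact ((ContinuousLinearMap.proj (R := ℝ) (φ := fun _ : Unit => ℝ) ()).comp
          (ContinuousLinearMap.snd ℝ (Fin n → ℝ) (Unit → ℝ))).analyticOnNhd _
      · exact hf.comp (analyticOnNhd_fst (𝕜 := ℝ)) fun p hp => hp.1
    · obtain ⟨x, hx, hxa⟩ := hne
      -- At this `u` the substitution takes the value 1.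
      exact ⟨(x, fun _ => (1 - f x) / a 0 x), ⟨hx, trivial⟩, (), by field_simp; simp⟩
  refine ⟨⟨hsub, fun _ _ z => a 0 z.1, fun _ _ => ⟨∅, fun p => a 0 p.1, ?_, fun _ _ => rfl⟩,
    fun z hz _ => ?_⟩, hsub, fun V _ hVU u hu x hx _ => ?_⟩
  · exact haU.comp (analyticOnNhd_fst (𝕜 := ℝ)) fun p hp => hp.1
  · rw [Finset.univ_unique, Finset.sum_singleton]
    refine (hadj _ (hUΩ hz) _).trans ?_
    rw [show (default : Unit) = () from rfl, hF]
    dsimp only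
    rw [multiIter_zero]
    rfl
  · refine (hadj _ (hUΩ (hVU hx)) _).trans ?_
    have h := hu.2 x hx ()
    rw [hF] at h
    simp only [jetOf, multiIter_zero, Sum.elim_inr] at h ⊢
    rw [h, mul_zero]

end adjoint

/-! ### Power series in several variables and analytic functions. -/

section series

open MvPowerSeries

variable {n : ℕ}

/-- The value at `y` of the monomial of multi-index `K`. -/
def monomialEval (y : Fin n → ℝ) (K : Fin n →₀ ℕ) : ℝ := ∏ i, y i ^ K i

@[simp]
theorem monomialEval_zero (y : Fin n → ℝ) : monomialEval y 0 = 1 := by simp [monomialEval]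

theorem monomialEval_add (y : Fin n → ℝ) (K L : Fin n →₀ ℕ) :
    monomialEval y (K + L) = monomialEval y K * monomialEval y L := by
  simp [monomialEval, pow_add, Finset.prod_mul_distrib]

@[simp]
theorem monomialEval_single (y : Fin n → ℝ) (i : Fin n) (m : ℕ) :
    monomialEval y (Finsupp.single i m) = y i ^ m := by
  unfold monomialEval
  rw [Finset.prod_eq_single i]
  · simp
  · intro j _ hj
    simp [hj.symm]
  · simp

theorem monomialEval_sum {ι : Type*} (y : Fin n → ℝ) (S : Finset ι) (K : ι → Fin n →₀ ℕ) :
    monomialEval y (∑ j ∈ S, K j) = ∏ j ∈ S, monomialEval y (K j) := by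
  induction S using Finset.cons_induction with
  | empty => simp
  | cons j S hj ih => rw [Finset.sum_cons, Finset.prod_cons, monomialEval_add, ih]

theorem monomialEval_const (t : ℝ) (K : Fin n →₀ ℕ) :
    monomialEval (fun _ => t) K = t ^ K.degree := by
  rw [monomialEval, Finset.prod_pow_eq_pow_sum, Finsupp.degree_eq_sum]

theorem abs_monomialEval_le {y : Fin n → ℝ} {t : ℝ} (h : ‖y‖ ≤ t) (K : Fin n →₀ ℕ) :
    |monomialEval y K| ≤ t ^ K.degree := by
  rw [← monomialEval_const, monomialEval, monomialEval, Finset.abs_prod]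
  refine Finset.prod_le_prod (fun _ _ => abs_nonneg _) fun i _ => ?_
  rw [abs_pow]
  exact pow_le_pow_left₀ (abs_nonneg _) ((norm_le_pi_norm y i).trans h) _

theorem monomialEval_update (y : Fin n → ℝ) (i : Fin n) (t : ℝ) (K : Fin n →₀ ℕ) :
    monomialEval (Function.update y i t) K = t ^ K i * monomialEval y (K.erase i) := by
  conv_lhs => rw [← Finsupp.single_add_erase i K]
  rw [monomialEval_add, monomialEval_single, Function.update_self]
  congr 1
  refine Finset.prod_congr rfl fun j _ => ?_
  by_cases hj : j = i
  · simp [hj]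
  · rw [Function.update_of_ne hj]

theorem exists_sum_single_eq {m : ℕ} {K : Fin n →₀ ℕ} (hK : K.degree = m) :
    ∃ σ : Fin m → Fin n, ∑ j, Finsupp.single (σ j) 1 = K := by
  induction m generalizing K with
  | zero => exact ⟨Fin.elim0, by simpa [eq_comm] using (Finsupp.degree_eq_zero_iff K).1 hK⟩
  | succ m ih =>
    obtain ⟨i, hi⟩ : ∃ i, 0 < K i := by
      by_contra! h
      have : K = 0 := Finsupp.ext fun i => Nat.le_zero.1 (h i)
      simp [this] at hK
    have h1 := sub_single_add_single hi
    have h2 := congrArg Finsupp.degree h1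
    simp only [map_add, Finsupp.degree_single] at h2
    obtain ⟨σ, hσ⟩ := ih (K := K - Finsupp.single i 1) (by omega)
    refine ⟨Fin.cons i σ, ?_⟩
    rw [Fin.sum_univ_succ]
    simp only [Fin.cons_zero, Fin.cons_succ]
    rw [hσ, add_comm, h1]

/-- A product of `m` coordinate forms, each of norm at most 1 for the sup norm. It need not be
symmetric, since only its diagonal values matter. -/
theorem exists_multilinear_eq_monomialEval {m : ℕ} {K : Fin n →₀ ℕ} (hK : K.degree = m) :
    ∃ q : ContinuousMultilinearMap ℝ (fun _ : Fin m => Fin n → ℝ) ℝ,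
      (∀ y, (q fun _ => y) = monomialEval y K) ∧ ‖q‖ ≤ 1 := by
  obtain ⟨σ, rfl⟩ := exists_sum_single_eq hK
  refine ⟨(ContinuousMultilinearMap.mkPiAlgebra ℝ (Fin m) ℝ).compContinuousLinearMap
    fun j => ContinuousLinearMap.proj (σ j), fun y => by simp [monomialEval_sum], ?_⟩
  refine ContinuousMultilinearMap.opNorm_le_bound zero_le_one fun v => ?_
  rw [one_mul]
  simp only [ContinuousMultilinearMap.compContinuousLinearMap_apply,
    ContinuousMultilinearMap.mkPiAlgebra_apply, ContinuousLinearMap.proj_apply, norm_prod]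
  exact Finset.prod_le_prod (fun _ _ => norm_nonneg _) fun j _ => norm_le_pi_norm (v j) (σ j)

/-- On the open polydisc of radius `r` around `x₀`, the function `f` is the sum of the power
series `c`. -/
def HasMvSeries (f : (Fin n → ℝ) → ℝ) (c : MvPowerSeries (Fin n) ℝ) (x₀ : Fin n → ℝ) (r : ℝ) :
    Prop :=
  ∀ y : Fin n → ℝ, ‖y‖ < r → HasSum (fun K => coeff K c * monomialEval y K) (f (x₀ + y))

namespace HasMvSeries

variable {f g : (Fin n → ℝ) → ℝ} {c d : MvPowerSeries (Fin n) ℝ} {x₀ : Fin n → ℝ} {r : ℝ}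

theorem mono {r' : ℝ} (h : HasMvSeries f c x₀ r) (hr : r' ≤ r) : HasMvSeries f c x₀ r' :=
  fun y hy => h y (hy.trans_le hr)

theorem summable_abs (h : HasMvSeries f c x₀ r) {t : ℝ} (ht : 0 ≤ t) (htr : t < r) :
    Summable fun K => |coeff K c| * t ^ K.degree := by
  have hn : ‖(fun _ => t : Fin n → ℝ)‖ < r := by
    refine lt_of_le_of_lt ?_ htr
    rw [pi_norm_le_iff_of_nonneg ht]
    intro i
    rw [Real.norm_of_nonneg ht]
  refine (h _ hn).summable.abs.congr fun K => ?_
  rw [monomialEval_const, abs_mul, abs_of_nonneg (pow_nonneg ht _)]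

theorem of_summable (h : Summable fun K => |coeff K c| * r ^ K.degree) :
    HasMvSeries (fun x => ∑' K, coeff K c * monomialEval (x - x₀) K) c x₀ r := by
  intro y hy
  simp only [add_sub_cancel_left]
  refine Summable.hasSum (Summable.of_norm_bounded h fun K => ?_)
  rw [norm_mul]
  exact mul_le_mul_of_nonneg_left (abs_monomialEval_le hy.le K) (norm_nonneg _)

theorem apply_center (h : HasMvSeries f c x₀ r) (hr : 0 < r) : f x₀ = coeff 0 c := by
  have h0 := h 0 (by simpa using hr)
  rw [add_zero] at h0
  refine h0.unique ?_
  convert hasSum_single (0 : Fin n →₀ ℕ) fun K hK => ?_ using 1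
  · simp
  · obtain ⟨i, hi⟩ := Finsupp.ne_iff.1 hK
    rw [monomialEval, Finset.prod_eq_zero (Finset.mem_univ i), mul_zero]
    simpa using hi

theorem eq_zero (h : HasMvSeries f 0 x₀ r) {x : Fin n → ℝ} (hx : x ∈ Metric.ball x₀ r) :
    f x = 0 := by
  have h0 := h (x - x₀) (by rwa [← dist_eq_norm])
  rw [add_sub_cancel] at h0
  exact h0.unique (by simp)

theorem add (hf : HasMvSeries f c x₀ r) (hg : HasMvSeries g d x₀ r) :
    HasMvSeries (fun x => f x + g x) (c + d) x₀ r := by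
  intro y hy
  simpa [add_mul] using (hf y hy).add (hg y hy)

theorem sum {ι : Type*} (S : Finset ι) {F : ι → (Fin n → ℝ) → ℝ}
    {C : ι → MvPowerSeries (Fin n) ℝ} (h : ∀ j ∈ S, HasMvSeries (F j) (C j) x₀ r) :
    HasMvSeries (fun x => ∑ j ∈ S, F j x) (∑ j ∈ S, C j) x₀ r := by
  intro y hy
  simpa [Finset.sum_mul] using hasSum_sum fun j hj => h j hj y hy

theorem mul (hf : HasMvSeries f c x₀ r) (hg : HasMvSeries g d x₀ r) :
    HasMvSeries (fun x => f x * g x) (c * d) x₀ r := by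
  intro y hy
  set a : (Fin n →₀ ℕ) → ℝ := fun K => coeff K c * monomialEval y K with ha
  set b : (Fin n →₀ ℕ) → ℝ := fun K => coeff K d * monomialEval y K with hb
  have h1 : HasSum a (f (x₀ + y)) := hf y hy
  have h2 : HasSum b (g (x₀ + y)) := hg y hy
  have h12 : Summable fun x : (Fin n →₀ ℕ) × (Fin n →₀ ℕ) => a x.1 * b x.2 :=
    summable_mul_of_summable_norm h1.summable.norm h2.summable.norm
  have h3 := summable_sum_mul_antidiagonal_of_summable_mul h12
  have h4 := h1.summable.tsum_mul_tsum_eq_tsum_sum_antidiagonal h2.summable h12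
  rw [h1.tsum_eq, h2.tsum_eq] at h4
  have h5 := h3.hasSum
  rw [← h4] at h5
  refine h5.congr_fun fun K => ?_
  rw [coeff_mul, Finset.sum_mul]
  refine Finset.sum_congr rfl fun p hp => ?_
  rw [← Finset.HasAntidiagonal.mem_antidiagonal.1 hp, monomialEval_add, ha, hb]
  ring

/-- The left side is one term of the binomial expansion of `(t + δ)^m`. It absorbs the factor
produced by differentiation into a slightly larger radius. -/
theorem natCast_mul_pow_pred_mul_le {t δ : ℝ} (ht : 0 ≤ t) (hδ : 0 ≤ δ) (m : ℕ) :
    m * t ^ (m - 1) * δ ≤ (t + δ) ^ m := by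
  induction m with
  | zero => simp
  | succ m ih =>
    have h1 : t ^ m ≤ (t + δ) ^ m := pow_le_pow_left₀ ht (by linarith) m
    have h2 : (m : ℝ) * t ^ m = m * t ^ (m - 1) * t := by
      cases m with
      | zero => simp
      | succ m => rw [Nat.add_sub_cancel, pow_succ]; ring
    rw [Nat.add_sub_cancel, Nat.cast_succ, add_mul, h2, pow_succ]
    have h3 := mul_le_mul_of_nonneg_right ih ht
    have h4 := mul_le_mul_of_nonneg_right h1 hδ
    nlinarith

/-- Termwise differentiation in the `i`-th variable alone. The derived terms are at most `|c_K| |K|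
t^(|K|-1)`, which is summable because the series converges absolutely at some `t' > t`. -/
theorem pderivX (h : HasMvSeries f c x₀ r) (i : Fin n) :
    HasMvSeries (pderivX i f) (pderiv ℝ i c) x₀ r := by
  intro y hy
  obtain ⟨t, hyt, htr⟩ := exists_between hy
  obtain ⟨t', htt', htr'⟩ := exists_between htr
  have ht : 0 ≤ t := (norm_nonneg y).trans hyt.le
  set G : (Fin n →₀ ℕ) → ℝ → ℝ := fun K τ => coeff K c * (τ ^ K i * monomialEval y (K.erase i))
    with hG
  set G' : (Fin n →₀ ℕ) → ℝ → ℝ :=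
    fun K τ => coeff K c * ((K i * τ ^ (K i - 1)) * monomialEval y (K.erase i)) with hG'
  have hGG' : ∀ K τ, HasDerivAt (G K) (G' K τ) τ := fun K τ =>
    ((hasDerivAt_pow (K i) τ).mul_const _).const_mul _
  set u : (Fin n →₀ ℕ) → ℝ := fun K => |coeff K c| * (K.degree * t ^ (K.degree - 1)) with hu
  have hsum_u : Summable u := by
    have h1 := (h.summable_abs (ht.trans htt'.le) htr').mul_right (t' - t)⁻¹
    refine Summable.of_nonneg_of_le (fun K => by positivity) (fun K => ?_) h1
    rw [hu, mul_assoc]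
    refine mul_le_mul_of_nonneg_left ?_ (abs_nonneg _)
    rw [← div_eq_mul_inv, le_div_iff₀ (by linarith)]
    simpa using natCast_mul_pow_pred_mul_le ht (sub_nonneg.2 htt'.le) K.degree
  have hbound : ∀ K, ∀ τ ∈ Metric.ball (0 : ℝ) t, ‖G' K τ‖ ≤ u K := by
    intro K τ hτ
    have hτ' : |τ| ≤ t := (mem_ball_zero_iff.1 hτ).le
    rw [hG', hu]
    simp only [norm_mul, Real.norm_eq_abs, abs_pow, Nat.abs_cast]
    refine mul_le_mul_of_nonneg_left ?_ (abs_nonneg _)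
    rcases Nat.eq_zero_or_pos (K i) with h0 | hpos
    · rw [h0]
      simp only [Nat.cast_zero, zero_mul]
      positivity
    · have hdeg : K.degree = K i + (K.erase i).degree := by
        conv_lhs => rw [← Finsupp.single_add_erase i K]
        rw [map_add, Finsupp.degree_single]
      have hle : (K i : ℝ) ≤ K.degree := by exact_mod_cast Finsupp.le_degree i K
      have : t ^ (K.degree - 1) = t ^ (K i - 1) * t ^ (K.erase i).degree := by
        rw [← pow_add, hdeg]
        congr 1
        omega
      rw [this, mul_assoc]
      refine mul_le_mul hle (mul_le_mul (pow_le_pow_left₀ (abs_nonneg _) hτ' _)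
        (abs_monomialEval_le hyt.le _) (abs_nonneg _) (by positivity)) (by positivity)
        (by positivity)
  have hyi : y i ∈ Metric.ball (0 : ℝ) t := by
    simpa using (norm_le_pi_norm y i).trans_lt hyt
  have hupd : ∀ τ ∈ Metric.ball (0 : ℝ) t,
      HasSum (fun K => G K τ) (f (x₀ + Function.update y i τ)) := by
    intro τ hτ
    have hn : ‖Function.update y i τ‖ < r := by
      refine lt_of_le_of_lt ?_ htr
      rw [pi_norm_le_iff_of_nonneg ht]
      intro j
      rcases eq_or_ne j i with rfl | hj
      · simpa using (mem_ball_zero_iff.1 hτ).le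
      · rw [Function.update_of_ne hj]
        exact (norm_le_pi_norm y j).trans hyt.le
    simpa only [monomialEval_update] using h _ hn
  have hderiv := hasDerivAt_tsum_of_isPreconnected hsum_u Metric.isOpen_ball
    (convex_ball (0 : ℝ) t).isPreconnected (fun K τ _ => hGG' K τ) hbound hyi
    (hupd _ hyi).summable hyi
  have hderiv' : HasDerivAt (fun τ => f (Function.update (x₀ + y) i τ)) (∑' K, G' K (y i))
      ((x₀ + y) i) := by
    have h1 : HasDerivAt (fun τ => ∑' K, G K (τ - x₀ i)) (∑' K, G' K (y i)) ((x₀ + y) i) := by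
      refine HasDerivAt.comp_sub_const (f := fun τ => ∑' K, G K τ) _ _ ?_
      simpa using hderiv
    refine h1.congr_of_eventuallyEq ?_
    have hev : ∀ᶠ τ in nhds ((x₀ + y) i), τ - x₀ i ∈ Metric.ball (0 : ℝ) t :=
      (continuous_id.sub continuous_const).continuousAt.eventually
        (Metric.isOpen_ball.mem_nhds (by simpa using hyi))
    filter_upwards [hev] with τ hτ
    rw [(hupd _ hτ).tsum_eq]
    congr 1
    ext j
    rcases eq_or_ne j i with rfl | hj
    · simp
    · simp [Function.update_of_ne hj]
  have hval : _root_.pderivX i f (x₀ + y) = ∑' K, G' K (y i) := hderiv'.deriv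
  have hs : HasSum (fun K => G' K (y i)) (∑' K, G' K (y i)) :=
    (Summable.of_norm_bounded hsum_u fun K => hbound K _ hyi).hasSum
  rw [hval]
  -- Derived terms with `K_i = 0` vanish; the others are reindexed by `K ↦ K + e_i`.
  have hinj : Function.Injective fun K : Fin n →₀ ℕ => K + Finsupp.single i 1 :=
    fun _ _ h => add_right_cancel h
  refine ((hinj.hasSum_iff ?_).2 hs).congr_fun ?_
  · intro K hK
    have hKi : K i = 0 := by
      by_contra hne
      exact hK ⟨_, sub_single_add_single (Nat.pos_of_ne_zero hne)⟩
    simp [hG', hKi]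
  · intro K
    have he : (K + Finsupp.single i 1).erase i = K.erase i := by
      rw [Finsupp.erase_add, Finsupp.erase_single, add_zero]
    have hm : monomialEval y K = y i ^ K i * monomialEval y (K.erase i) := by
      simpa using monomialEval_update y i (y i) K
    simp only [hG', Function.comp_apply, he, coeff_pderiv, hm]
    simp
    ring

/-- Monomials of equal degree are grouped into one homogeneous polynomial, the value of a
multilinear map on the diagonal. -/
theorem analyticOnNhd (h : HasMvSeries f c x₀ r) (hr : 0 < r) :
    AnalyticOnNhd ℝ f (Metric.ball x₀ r) := by
  classical
  have : ∀ m, Fintype {K : Fin n →₀ ℕ // K.degree = m} := fun m =>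
    (Finsupp.finite_of_degree_eq m).fintype
  choose q hq hq1 using fun (m : ℕ) (K : {K : Fin n →₀ ℕ // K.degree = m}) =>
    exists_multilinear_eq_monomialEval K.2
  let p : FormalMultilinearSeries ℝ (Fin n → ℝ) ℝ := fun m => ∑ K, coeff K.1 c • q m K
  have hp : HasFPowerSeriesOnBall f p x₀ (ENNReal.ofReal r) := by
    refine ⟨ENNReal.le_of_forall_nnreal_lt fun t ht => ?_, by simpa using hr, fun {y} hy => ?_⟩
    · have htr : (t : ℝ) < r := by
        rw [← ENNReal.ofReal_coe_nnreal] at ht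
        exact (ENNReal.ofReal_lt_ofReal_iff hr).1 ht
      have h1 := ((Equiv.sigmaFiberEquiv (Finsupp.degree (σ := Fin n) (R := ℕ))).summable_iff.2
        (h.summable_abs t.2 htr)).sigma
      refine p.le_radius_of_summable (Summable.of_nonneg_of_le (fun m => by positivity)
        (fun m => ?_) h1)
      rw [tsum_fintype]
      calc ‖p m‖ * (t : ℝ) ^ m ≤ (∑ K : {K : Fin n →₀ ℕ // K.degree = m}, |coeff K.1 c|) * t ^ m := by
            refine mul_le_mul_of_nonneg_right ((norm_sum_le _ _).trans
              (Finset.sum_le_sum fun K _ => ?_)) (by positivity)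
            rw [norm_smul]
            exact mul_le_of_le_one_right (norm_nonneg _) (hq1 m K)
        _ = _ := by
            rw [Finset.sum_mul]
            refine Finset.sum_congr rfl fun K _ => ?_
            change _ = |coeff K.1 c| * (t : ℝ) ^ K.1.degree
            rw [K.2]
    · have hy' : ‖y‖ < r := by
        rw [Metric.eball_ofReal] at hy
        simpa using hy
      have h1 := (Equiv.sigmaFiberEquiv (Finsupp.degree (σ := Fin n) (R := ℕ))).hasSum_iff.2
        (h y hy')
      refine h1.sigma fun m => ?_
      have h2 : (p m fun _ => y) = ∑ K : {K : Fin n →₀ ℕ // K.degree = m},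
          coeff K.1 c * monomialEval y K.1 := by
        simp only [p, sum_apply, smul_apply, hq,
          smul_eq_mul]
      rw [h2]
      exact hasSum_fintype _
  rw [← Metric.eball_ofReal]
  exact hp.analyticOnNhd

end HasMvSeries

/-- Expanding `p m (y, …, y)` in the standard basis gives one term per word in `Fin m → Fin n`;
words with the same letter count `content` contribute to the same monomial. -/
theorem AnalyticAt.exists_hasMvSeries {f : (Fin n → ℝ) → ℝ} {x₀ : Fin n → ℝ}
    (hf : AnalyticAt ℝ f x₀) : ∃ r > 0, ∃ c, HasMvSeries f c x₀ r := by
  obtain ⟨p, R, hp⟩ := hf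
  let content : (Σ m : ℕ, Fin m → Fin n) → (Fin n →₀ ℕ) :=
    fun σ => ∑ j, Finsupp.single (σ.2 j) 1
  let A : (Σ m : ℕ, Fin m → Fin n) → ℝ := fun σ => p σ.1 fun j => Pi.single (σ.2 j) 1
  have hcontent : ∀ y σ, monomialEval y (content σ) = ∏ j, y (σ.2 j) := by
    intro y σ
    simp [content, monomialEval_sum]
  obtain ⟨t, ht0, htR⟩ : ∃ t : NNReal, 0 < t ∧ (t : ENNReal) < R := by
    obtain ⟨t, h1, h2⟩ := ENNReal.lt_iff_exists_nnreal_btwn.1 hp.r_pos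
    exact ⟨t, by exact_mod_cast h1, h2⟩
  have hA : ∀ σ, |A σ| ≤ ‖p σ.1‖ := by
    intro σ
    refine ((p σ.1).le_opNorm _).trans ?_
    simp [Pi.norm_single]
  -- There are `n^m` words of length `m`, so absolute convergence needs `n ‖y‖ ≤ t`. The `+ 1` keeps
  -- the denominator positive when `n = 0`.
  refine ⟨t / (n + 1), by positivity, fun K => ∑' σ : {σ // content σ = K}, A σ, fun y hy => ?_⟩
  have hy' : (n + 1) * ‖y‖ < t := by
    rw [lt_div_iff₀ (by positivity)] at hy
    linarith
  have hsum : Summable fun σ => A σ * monomialEval y (content σ) := by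
    have hpt := p.summable_norm_mul_pow (htR.trans_le hp.r_le)
    have hmaj : Summable fun σ : (Σ m : ℕ, Fin m → Fin n) => ‖p σ.1‖ * ‖y‖ ^ σ.1 := by
      rw [summable_sigma_of_nonneg (fun _ => by positivity)]
      refine ⟨fun m => (hasSum_fintype _).summable, ?_⟩
      refine Summable.of_nonneg_of_le (fun m => tsum_nonneg fun _ => by positivity)
        (fun m => ?_) hpt
      have hcard : ∑' _σ : Fin m → Fin n, ‖p m‖ * ‖y‖ ^ m = (n : ℝ) ^ m * (‖p m‖ * ‖y‖ ^ m) := by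
        rw [tsum_fintype, Finset.sum_const, Finset.card_univ, nsmul_eq_mul]
        simp
      refine hcard.trans_le ?_
      calc (n : ℝ) ^ m * (‖p m‖ * ‖y‖ ^ m) = ‖p m‖ * (n * ‖y‖) ^ m := by rw [mul_pow]; ring
        _ ≤ ‖p m‖ * (t : ℝ) ^ m := by
          gcongr
          nlinarith [norm_nonneg y]
    refine Summable.of_norm_bounded hmaj fun σ => ?_
    rw [norm_mul]
    refine mul_le_mul (hA σ) ?_ (norm_nonneg _) (norm_nonneg _)
    rw [hcontent, Real.norm_eq_abs, Finset.abs_prod]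
    calc ∏ j, |y (σ.2 j)| ≤ ∏ _j : Fin σ.1, ‖y‖ :=
          Finset.prod_le_prod (fun _ _ => abs_nonneg _) fun j _ => norm_le_pi_norm y _
      _ = ‖y‖ ^ σ.1 := by simp
  have hval : HasSum (fun σ => A σ * monomialEval y (content σ)) (f (x₀ + y)) := by
    have h1 : HasSum (fun m => p m fun _ => y) (f (x₀ + y)) := by
      refine hp.hasSum ?_
      rw [Metric.mem_eball, edist_zero_right]
      refine lt_of_le_of_lt ?_ htR
      rw [enorm_eq_nnnorm]
      have : ‖y‖ ≤ t := by nlinarith [norm_nonneg y]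
      exact_mod_cast this
    have h2 : ∀ m, HasSum (fun σ : Fin m → Fin n => A ⟨m, σ⟩ * monomialEval y (content ⟨m, σ⟩))
        (p m fun _ => y) := by
      intro m
      have hy : y = ∑ i, y i • (Pi.single i 1 : Fin n → ℝ) := by
        simpa using pi_eq_sum_univ' y
      have h3 : (p m fun _ => y) = ∑ σ : Fin m → Fin n,
          A ⟨m, σ⟩ * monomialEval y (content ⟨m, σ⟩) := by
        conv_lhs => rw [hy]
        rw [(p m).map_sum]
        refine Finset.sum_congr rfl fun σ _ => ?_
        rw [(p m).map_smul_univ, hcontent, smul_eq_mul, mul_comm]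
      rw [h3]
      exact hasSum_fintype _
    have h4 := hsum.hasSum.sigma h2
    rw [← h4.unique h1]
    exact hsum.hasSum
  have hfib := ((Equiv.sigmaFiberEquiv content).hasSum_iff.2 hval)
  have := hfib.sigma fun K => (hfib.summable.comp_injective
    (sigma_mk_injective (i := K))).hasSum
  refine this.congr_fun fun K => ?_
  change (∑' σ : {σ // content σ = K}, A σ) * monomialEval y K = _
  rw [← tsum_mul_right]
  refine tsum_congr fun σ => ?_
  change A σ * monomialEval y K = A σ * monomialEval y (content σ)
  rw [σ.2]

end series

/-! ### Formal derivatives and antiderivatives, weighted norms and the Neumann series. -/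

section formal

open MvPowerSeries

variable {n : ℕ}

/-- The factorial of a multi-index. -/
def multiFactorial (K : Fin n →₀ ℕ) : ℕ := ∏ i, (K i).factorial

theorem multiFactorial_pos (K : Fin n →₀ ℕ) : 0 < multiFactorial K :=
  Finset.prod_pos fun _ _ => Nat.factorial_pos _

theorem multiFactorial_add_single (K : Fin n →₀ ℕ) (i : Fin n) :
    multiFactorial (K + Finsupp.single i 1) = multiFactorial K * (K i + 1) := by
  unfold multiFactorial
  rw [← Finset.mul_prod_erase _ _ (Finset.mem_univ i),
    ← Finset.mul_prod_erase (a := i) _ (fun j => (K j).factorial) (Finset.mem_univ i)]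
  have : ∏ j ∈ Finset.univ.erase i, ((K + Finsupp.single i 1 : Fin n →₀ ℕ) j).factorial =
      ∏ j ∈ Finset.univ.erase i, (K j).factorial := by
    refine Finset.prod_congr rfl fun j hj => ?_
    simp [(Finset.ne_of_mem_erase hj).symm]
  rw [this]
  simp only [Finsupp.add_apply, Finsupp.single_eq_same, Nat.factorial_succ]
  ring

/-- The iterated formal partial derivative of a power series. -/
noncomputable def formalD (I : Fin n →₀ ℕ) (c : MvPowerSeries (Fin n) ℝ) :
    MvPowerSeries (Fin n) ℝ :=
  multiIter (fun i => pderiv ℝ i) I c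

/-- After scaling coefficients by `K!`, differentiation is a pure shift of indices. Other identities
for `formalD` follow by cancelling `K!`. -/
theorem coeff_formalD_mul (I K : Fin n →₀ ℕ) (c : MvPowerSeries (Fin n) ℝ) :
    coeff K (formalD I c) * multiFactorial K = coeff (K + I) c * multiFactorial (K + I) := by
  refine multiIter_induction (fun A H => ∀ K, coeff K H * multiFactorial K =
    coeff (K + A) c * multiFactorial (K + A)) (fun K => by simp) (fun i A H h K => ?_) I K
  have h1 := h (K + Finsupp.single i 1)
  rw [multiFactorial_add_single, add_assoc, add_comm (Finsupp.single i 1)] at h1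
  rw [coeff_pderiv, ← h1]
  push_cast
  ring

theorem formalD_add (I : Fin n →₀ ℕ) (c d : MvPowerSeries (Fin n) ℝ) :
    formalD I (c + d) = formalD I c + formalD I d := by
  ext K
  have hK : (multiFactorial K : ℝ) ≠ 0 := by exact_mod_cast (multiFactorial_pos K).ne'
  refine mul_right_cancel₀ hK ?_
  rw [map_add, add_mul]
  simp only [coeff_formalD_mul, map_add, add_mul]

theorem formalD_one (I : Fin n →₀ ℕ) :
    formalD I (1 : MvPowerSeries (Fin n) ℝ) = if I = 0 then 1 else 0 := by
  classical
  split_ifs with h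
  · rw [h, formalD, multiIter_zero]
  · ext K
    have hK : (multiFactorial K : ℝ) ≠ 0 := by exact_mod_cast (multiFactorial_pos K).ne'
    refine mul_right_cancel₀ hK ?_
    rw [coeff_formalD_mul, coeff_one, if_neg (by simp [h])]
    simp

theorem HasMvSeries.multiIter_pderivX {f : (Fin n → ℝ) → ℝ} {c : MvPowerSeries (Fin n) ℝ}
    {x₀ : Fin n → ℝ} {r : ℝ} (h : HasMvSeries f c x₀ r) (I : Fin n →₀ ℕ) :
    HasMvSeries (multiIter _root_.pderivX I f) (formalD I c) x₀ r := by
  -- Function and series are differentiated together as a pair; `key` then separates the two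
  -- components.
  have := multiIter_induction (D := fun i (p : ((Fin n → ℝ) → ℝ) × MvPowerSeries (Fin n) ℝ) =>
    (_root_.pderivX i p.1, pderiv ℝ i p.2)) (G := (f, c))
    (fun _ p => HasMvSeries p.1 p.2 x₀ r) h (fun i _ p hp => hp.pderivX i) I
  have key : ∀ l : List (Fin n), l.foldr (fun i H => (fun p : ((Fin n → ℝ) → ℝ) ×
      MvPowerSeries (Fin n) ℝ => (_root_.pderivX i p.1, pderiv ℝ i p.2))^[I i] H) (f, c) =
      (l.foldr (fun i H => (_root_.pderivX i)^[I i] H) f,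
        l.foldr (fun i H => (pderiv ℝ i)^[I i] H) c) := by
    intro l
    induction l with
    | nil => rfl
    | cons i l ih =>
      simp only [List.foldr_cons, ih]
      generalize l.foldr (fun i H => (_root_.pderivX i)^[I i] H) f = f'
      generalize l.foldr (fun i H => (pderiv ℝ i)^[I i] H) c = c'
      induction I i with
      | zero => rfl
      | succ m ihm => simp only [Function.iterate_succ_apply', ihm]
  unfold multiIter at this
  rw [key] at this
  exact this

/-- The coefficients of the derivative of multi-index `I` of the `J`-fold antiderivative of `Y`
that is divisible by `X ^ J`. -/
noncomputable def derivAntiderivCoeff (J I : Fin n →₀ ℕ) (Y : MvPowerSeries (Fin n) ℝ)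
    (Q : Fin n →₀ ℕ) : ℝ :=
  if J ≤ Q + I then
    coeff (Q + I - J) Y * (multiFactorial (Q + I - J) / multiFactorial Q) else 0

/-- The derivative of multi-index `I` of the `J`-fold antiderivative that is divisible
by `X ^ J`, as a linear map. -/
noncomputable def derivAntideriv (J I : Fin n →₀ ℕ) :
    MvPowerSeries (Fin n) ℝ →ₗ[ℝ] MvPowerSeries (Fin n) ℝ where
  toFun Y := derivAntiderivCoeff J I Y
  map_add' Y Z := by
    ext Q
    change derivAntiderivCoeff J I (Y + Z) Q =
      derivAntiderivCoeff J I Y Q + derivAntiderivCoeff J I Z Q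
    unfold derivAntiderivCoeff
    split_ifs
    · rw [map_add, add_mul]
    · simp
  map_smul' t Y := by
    ext Q
    change derivAntiderivCoeff J I (t • Y) Q = t * derivAntiderivCoeff J I Y Q
    unfold derivAntiderivCoeff
    split_ifs
    · rw [coeff_smul, mul_assoc]
    · simp

theorem coeff_derivAntideriv (J I Q : Fin n →₀ ℕ) (Y : MvPowerSeries (Fin n) ℝ) :
    coeff Q (derivAntideriv J I Y) = if J ≤ Q + I then
      coeff (Q + I - J) Y * (multiFactorial (Q + I - J) / multiFactorial Q) else 0 := rfl

/-- `∂^I ∂^{-J}` is handled as a single operator, without requiring `I ≤ J`: it is bounded in the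
weighted norms used below when `|I| ≤ |J|`, whereas `∂^I` alone need not be. -/
theorem formalD_derivAntideriv (J I : Fin n →₀ ℕ) (Y : MvPowerSeries (Fin n) ℝ) :
    formalD I (derivAntideriv J 0 Y) = derivAntideriv J I Y := by
  ext K
  have hK : (multiFactorial K : ℝ) ≠ 0 := by exact_mod_cast (multiFactorial_pos K).ne'
  have hK' : (multiFactorial (K + I) : ℝ) ≠ 0 := by
    exact_mod_cast (multiFactorial_pos (K + I)).ne'
  refine mul_right_cancel₀ hK ?_
  rw [coeff_formalD_mul, coeff_derivAntideriv, coeff_derivAntideriv, add_zero]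
  split_ifs
  · field_simp
  · simp

theorem derivAntideriv_self (J : Fin n →₀ ℕ) (Y : MvPowerSeries (Fin n) ℝ) :
    derivAntideriv J J Y = Y := by
  ext K
  have hK : (multiFactorial K : ℝ) ≠ 0 := by exact_mod_cast (multiFactorial_pos K).ne'
  rw [coeff_derivAntideriv, if_pos le_add_self, add_tsub_cancel_right, div_self hK, mul_one]

open scoped MvPowerSeries.WithPiTopology in
theorem continuous_derivAntideriv (J I : Fin n →₀ ℕ) : Continuous (derivAntideriv J I) := by
  refine continuous_pi fun Q => ?_
  change Continuous fun Y : MvPowerSeries (Fin n) ℝ => if J ≤ Q + I then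
      coeff (Q + I - J) Y * ((multiFactorial (Q + I - J) : ℝ) / multiFactorial Q) else 0
  split_ifs
  · exact (WithPiTopology.continuous_coeff ℝ _).mul continuous_const
  · exact continuous_const

/-- The weighted `ℓ¹` norm of a power series. -/
noncomputable def weightedNorm (w : (Fin n →₀ ℕ) → ℝ) (Y : MvPowerSeries (Fin n) ℝ) : ENNReal :=
  ∑' K, ‖coeff K Y‖ₑ * ENNReal.ofReal (w K)

theorem weightedNorm_add_le (w : (Fin n →₀ ℕ) → ℝ) (Y Z : MvPowerSeries (Fin n) ℝ) :
    weightedNorm w (Y + Z) ≤ weightedNorm w Y + weightedNorm w Z := by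
  unfold weightedNorm
  rw [← ENNReal.tsum_add]
  refine ENNReal.tsum_le_tsum fun K => ?_
  rw [← add_mul, map_add]
  gcongr
  exact enorm_add_le _ _

@[simp]
theorem weightedNorm_zero (w : (Fin n →₀ ℕ) → ℝ) :
    weightedNorm w (0 : MvPowerSeries (Fin n) ℝ) = 0 := by
  simp [weightedNorm]

@[simp]
theorem weightedNorm_neg (w : (Fin n →₀ ℕ) → ℝ) (Y : MvPowerSeries (Fin n) ℝ) :
    weightedNorm w (-Y) = weightedNorm w Y := by
  simp [weightedNorm]

theorem weightedNorm_one (w : (Fin n →₀ ℕ) → ℝ) :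
    weightedNorm w (1 : MvPowerSeries (Fin n) ℝ) = ENNReal.ofReal (w 0) := by
  classical
  unfold weightedNorm
  rw [tsum_eq_single 0]
  · simp
  · intro K hK
    simp [coeff_one, hK]

theorem weightedNorm_sum_le {ι : Type*} (w : (Fin n →₀ ℕ) → ℝ) (S : Finset ι)
    (Y : ι → MvPowerSeries (Fin n) ℝ) :
    weightedNorm w (∑ j ∈ S, Y j) ≤ ∑ j ∈ S, weightedNorm w (Y j) := by
  induction S using Finset.cons_induction with
  | empty => simp
  | cons j S hj ih =>
    rw [Finset.sum_cons, Finset.sum_cons]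
    exact (weightedNorm_add_le _ _ _).trans (by gcongr)

theorem weightedNorm_mul_le {w : (Fin n →₀ ℕ) → ℝ} (hw0 : ∀ K, 0 ≤ w K)
    (hw : ∀ K L, w (K + L) ≤ w K * w L) (Y Z : MvPowerSeries (Fin n) ℝ) :
    weightedNorm w (Y * Z) ≤ weightedNorm w Y * weightedNorm w Z := by
  classical
  have hprod : weightedNorm w Y * weightedNorm w Z =
      ∑' p : (Fin n →₀ ℕ) × (Fin n →₀ ℕ), (‖coeff p.1 Y‖ₑ * ENNReal.ofReal (w p.1)) *
        (‖coeff p.2 Z‖ₑ * ENNReal.ofReal (w p.2)) := by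
    rw [ENNReal.tsum_prod']
    simp only [weightedNorm, ENNReal.tsum_mul_left, ENNReal.tsum_mul_right]
  rw [hprod, ← Finset.HasAntidiagonal.sigmaAntidiagonalEquivProd.tsum_eq, ENNReal.tsum_sigma']
  refine ENNReal.tsum_le_tsum fun K => ?_
  rw [coeff_mul]
  have h1 : ‖∑ p ∈ Finset.HasAntidiagonal.antidiagonal K, coeff p.1 Y * coeff p.2 Z‖ₑ ≤
      ∑ p ∈ Finset.HasAntidiagonal.antidiagonal K, ‖coeff p.1 Y‖ₑ * ‖coeff p.2 Z‖ₑ := by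
    refine (enorm_sum_le _ _).trans (Finset.sum_le_sum fun p _ => ?_)
    rw [enorm_mul]
  rw [tsum_fintype]
  refine (mul_le_mul_left h1 _).trans ?_
  rw [Finset.sum_mul, ← Finset.sum_coe_sort (Finset.HasAntidiagonal.antidiagonal K)]
  refine Finset.sum_le_sum fun p _ => ?_
  have hp : p.1.1 + p.1.2 = K := Finset.HasAntidiagonal.mem_antidiagonal.1 p.2
  change _ ≤ (‖coeff p.1.1 Y‖ₑ * ENNReal.ofReal (w p.1.1)) *
        (‖coeff p.1.2 Z‖ₑ * ENNReal.ofReal (w p.1.2))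
  rw [mul_mul_mul_comm, ← ENNReal.ofReal_mul (hw0 _)]
  gcongr
  have := hw p.1.1 p.1.2
  rwa [hp] at this

/-- Each `X^K` goes to zero or to `(K!/Q!) X^Q` with `Q + I = K + J`, and distinct `K` give distinct
`Q`. So the operator norm is governed by the ratios `K! w_Q / (Q! w_K)`. -/
theorem weightedNorm_derivAntideriv_le {w : (Fin n →₀ ℕ) → ℝ} {J I : Fin n →₀ ℕ} {C : ℝ}
    (hC : 0 ≤ C) (h : ∀ K Q, Q + I = K + J →
      multiFactorial K * w Q ≤ C * (multiFactorial Q * w K)) (Y : MvPowerSeries (Fin n) ℝ) :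
    weightedNorm w (derivAntideriv J I Y) ≤ ENNReal.ofReal C * weightedNorm w Y := by
  unfold weightedNorm
  have hsupp : Function.support (fun Q => ‖coeff Q (derivAntideriv J I Y)‖ₑ *
      ENNReal.ofReal (w Q)) ⊆ {Q | J ≤ Q + I} := by
    intro Q hQ
    by_contra hn
    have hn' : ¬ J ≤ Q + I := hn
    refine hQ ?_
    dsimp only
    rw [coeff_derivAntideriv, if_neg hn']
    simp
  rw [← tsum_subtype_eq_of_support_subset hsupp, ← ENNReal.tsum_mul_left]
  have hinj : Function.Injective fun Q : {Q : Fin n →₀ ℕ | J ≤ Q + I} => Q.1 + I - J := by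
    intro Q Q' hQ
    have h1 : Q.1 + I - J + J = Q'.1 + I - J + J := congrArg (· + J) hQ
    rw [tsub_add_cancel_of_le Q.2, tsub_add_cancel_of_le Q'.2] at h1
    exact Subtype.ext (add_right_cancel h1)
  refine le_trans (ENNReal.tsum_le_tsum fun Q => ?_) (ENNReal.tsum_comp_le_tsum_of_injective hinj
    fun K => ENNReal.ofReal C * (‖coeff K Y‖ₑ * ENNReal.ofReal (w K)))
  have hQ : J ≤ Q.1 + I := Q.2
  rw [coeff_derivAntideriv, if_pos hQ, enorm_mul, mul_left_comm, mul_assoc]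
  refine mul_le_mul_right ?_ _
  have hpos : (0 : ℝ) < multiFactorial Q.1 := by exact_mod_cast multiFactorial_pos Q.1
  rw [Real.enorm_eq_ofReal (by positivity), ← ENNReal.ofReal_mul (by positivity),
    ← ENNReal.ofReal_mul hC]
  refine ENNReal.ofReal_le_ofReal ?_
  have := h (Q.1 + I - J) Q.1 (tsub_add_cancel_of_le hQ).symm
  rw [div_mul_eq_mul_div, div_le_iff₀ hpos]
  linarith

open scoped MvPowerSeries.WithPiTopology in
/-- Neumann series for a contraction in a weighted `ℓ¹` norm. -/
theorem exists_eq_add_of_contraction {w : (Fin n →₀ ℕ) → ℝ} (hw0 : ∀ K, 0 < w K)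
    (M : MvPowerSeries (Fin n) ℝ →L[ℝ] MvPowerSeries (Fin n) ℝ) {κ : ENNReal} (hκ : κ < 1)
    (hM : ∀ Y, weightedNorm w (M Y) ≤ κ * weightedNorm w Y) {g : MvPowerSeries (Fin n) ℝ}
    (hg : weightedNorm w g ≠ ⊤) :
    ∃ Y, weightedNorm w Y ≠ ⊤ ∧ Y = g + M Y := by
  set G : ℕ → MvPowerSeries (Fin n) ℝ := fun j => M^[j] g with hG
  have hGsucc : ∀ j, G (j + 1) = M (G j) := fun j => Function.iterate_succ_apply' _ _ _
  have hGnorm : ∀ j, weightedNorm w (G j) ≤ κ ^ j * weightedNorm w g := by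
    intro j
    induction j with
    | zero => simp [hG]
    | succ j ih =>
      rw [hGsucc, pow_succ', mul_assoc]
      exact (hM _).trans (mul_le_mul_right ih _)
  have htot : ∑' j, weightedNorm w (G j) ≠ ⊤ := by
    refine ne_top_of_le_ne_top ?_ (ENNReal.tsum_le_tsum hGnorm)
    rw [ENNReal.tsum_mul_right, ENNReal.tsum_geometric]
    refine ENNReal.mul_ne_top ?_ hg
    rw [ENNReal.inv_ne_top]
    exact (tsub_pos_of_lt hκ).ne'
  have hcomm : ∑' j, weightedNorm w (G j) =
      ∑' K, (∑' j, ‖coeff K (G j)‖ₑ) * ENNReal.ofReal (w K) := by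
    simp only [weightedNorm]
    rw [ENNReal.tsum_comm]
    simp only [ENNReal.tsum_mul_right]
  rw [hcomm] at htot
  have hsum : ∀ K, Summable fun j => coeff K (G j) := by
    intro K
    have h1 := ENNReal.ne_top_of_tsum_ne_top htot K
    have h2 : ∑' j, ‖coeff K (G j)‖ₑ ≠ ⊤ := by
      intro h
      rw [h, ENNReal.top_mul (by simpa using hw0 K)] at h1
      exact h1 rfl
    have h3 := ENNReal.summable_toReal h2
    simp only [toReal_enorm] at h3
    exact h3.of_norm
  let Y : MvPowerSeries (Fin n) ℝ := fun K => ∑' j, coeff K (G j)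
  have hY : HasSum G Y := WithPiTopology.hasSum_iff_hasSum_coeff.2 fun K => (hsum K).hasSum
  refine ⟨Y, ne_top_of_le_ne_top htot (ENNReal.tsum_le_tsum fun K => ?_), ?_⟩
  · gcongr
    exact enorm_tsum_le_tsum_enorm
  -- The norm bounds give summability of each coefficient; continuity of `M` for the coefficientwise
  -- topology then carries `M` through the sum.
  · have h1 : HasSum (fun j => G (j + 1)) (M Y) := by
      simp only [hGsucc]
      exact M.hasSum hY
    have h2 := (hasSum_nat_add_iff' 1).2 hY
    have h3 := h1.unique h2
    rw [h3]
    simp [hG]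

/-- A formal solution, of finite weighted norm, of a linear differential equation with a dominant
term `∂^J`. -/
theorem exists_formal_solution {w : (Fin n →₀ ℕ) → ℝ} (hw0 : ∀ K, 0 < w K)
    (hw : ∀ K L, w (K + L) ≤ w K * w L) {J : Fin n →₀ ℕ} (hJ : J ≠ 0)
    {S : Finset (Fin n →₀ ℕ)} (hS : 0 ∈ S) (β : (Fin n →₀ ℕ) → MvPowerSeries (Fin n) ℝ)
    {C : (Fin n →₀ ℕ) → ℝ} (hC0 : ∀ I ∈ S, 0 ≤ C I)
    (hC : ∀ I ∈ S, ∀ K Q, Q + I = K + J →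
      multiFactorial K * w Q ≤ C I * (multiFactorial Q * w K))
    (hβ : weightedNorm w (β 0) ≠ ⊤)
    (hsmall : ∑ I ∈ S, weightedNorm w (β I) * ENNReal.ofReal (C I) < 1) :
    ∃ v : MvPowerSeries (Fin n) ℝ, coeff 0 v = 1 ∧ weightedNorm w v ≠ ⊤ ∧
      formalD J v + ∑ I ∈ S, β I * formalD I v = 0 := by
  classical
  let : TopologicalSpace (MvPowerSeries (Fin n) ℝ) := WithPiTopology.instTopologicalSpace ℝ
  have : IsTopologicalRing (MvPowerSeries (Fin n) ℝ) :=
    WithPiTopology.instIsTopologicalRing (Fin n) ℝ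
  let M : MvPowerSeries (Fin n) ℝ →L[ℝ] MvPowerSeries (Fin n) ℝ :=
    { toLinearMap := -∑ I ∈ S, (LinearMap.mulLeft ℝ (β I)).comp (derivAntideriv J I)
      cont := by
        change Continuous fun Y =>
          (-∑ I ∈ S, (LinearMap.mulLeft ℝ (β I)).comp (derivAntideriv J I)) Y
        simp only [LinearMap.neg_apply, LinearMap.sum_apply, LinearMap.comp_apply,
          LinearMap.mulLeft_apply]
        exact (continuous_finsetSum _ fun I _ =>
          continuous_const.mul (continuous_derivAntideriv J I)).neg }
  have hMapp : ∀ Y, M Y = -∑ I ∈ S, β I * derivAntideriv J I Y := by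
    intro Y
    change (-∑ I ∈ S, (LinearMap.mulLeft ℝ (β I)).comp (derivAntideriv J I)) Y = _
    simp
  obtain ⟨Y, hYn, hY⟩ := exists_eq_add_of_contraction hw0 M hsmall (g := -β 0) (fun Y => by
    rw [hMapp, weightedNorm_neg, Finset.sum_mul]
    refine (weightedNorm_sum_le _ _ _).trans (Finset.sum_le_sum fun I hI => ?_)
    refine (weightedNorm_mul_le (fun K => (hw0 K).le) hw _ _).trans ?_
    rw [mul_assoc]
    exact mul_le_mul_right (weightedNorm_derivAntideriv_le (hC0 I hI) (hC I hI) Y) _) (by simpa)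
  -- Since `∂^I 1 = 0` unless `I = 0`, the constant 1 contributes exactly the term `β 0`, which the
  -- source `-β 0` cancels.
  refine ⟨1 + derivAntideriv J 0 Y, ?_, ?_, ?_⟩
  · rw [map_add, coeff_derivAntideriv, if_neg]
    · simp
    · simpa using hJ
  · refine ne_top_of_le_ne_top ?_ (weightedNorm_add_le _ _ _)
    rw [weightedNorm_one]
    refine ENNReal.add_ne_top.2 ⟨ENNReal.ofReal_ne_top, ?_⟩
    exact ne_top_of_le_ne_top (ENNReal.mul_ne_top ENNReal.ofReal_ne_top hYn)
      (weightedNorm_derivAntideriv_le (hC0 0 hS) (hC 0 hS) Y)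
  · simp only [formalD_add, formalD_one, formalD_derivAntideriv, derivAntideriv_self, if_neg hJ,
      zero_add, mul_add, Finset.sum_add_distrib, mul_ite, mul_one, mul_zero, Finset.sum_ite_eq',
      if_pos hS]
    rw [hMapp] at hY
    nth_rewrite 1 [hY]
    ring

end formal

/-! ### Multinomial weights and the choice of polyradii. -/

section weights

open MvPowerSeries

variable {n : ℕ}

theorem choose_mul_choose_le_choose_add (a b c d : ℕ) :
    a.choose b * c.choose d ≤ (a + c).choose (b + d) := by
  rw [Nat.add_choose_eq]
  exact Finset.single_le_sum (f := fun p : ℕ × ℕ => a.choose p.1 * c.choose p.2)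
    (fun _ _ => Nat.zero_le _) (a := (b, d)) (Finset.HasAntidiagonal.mem_antidiagonal.2 rfl)

/-- Vandermonde's identity applied to each binomial factor. This is what makes the multinomial
weights submultiplicative, so that the weighted norm respects products. -/
theorem multinomial_mul_multinomial_le {ι : Type*} (S : Finset ι) (f g : ι → ℕ) :
    Nat.multinomial S f * Nat.multinomial S g ≤ Nat.multinomial S (f + g) := by
  induction S using Finset.cons_induction with
  | empty => simp
  | cons i S hi ih =>
    rw [Nat.multinomial_cons, Nat.multinomial_cons, Nat.multinomial_cons, mul_mul_mul_comm]
    refine Nat.mul_le_mul ?_ ih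
    refine (choose_mul_choose_le_choose_add _ _ _ _).trans_eq ?_
    simp only [Pi.add_apply, Finset.sum_add_distrib]
    congr 1
    ring

theorem multinomial_le_two_pow {ι : Type*} (S : Finset ι) (f : ι → ℕ) {m : ℕ}
    (hm : ∑ i ∈ S, f i ≤ m) : Nat.multinomial S f ≤ (2 ^ m) ^ S.card := by
  induction S using Finset.cons_induction with
  | empty => simp
  | cons i S hi ih =>
    rw [Finset.sum_cons] at hm
    rw [Nat.multinomial_cons, Finset.card_cons, pow_succ']
    refine Nat.mul_le_mul ?_ (ih (by omega))
    exact (Nat.choose_le_two_pow _ _).trans (Nat.pow_le_pow_right (by norm_num) hm)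

/-- The weight `y ^ K * K! / |K|!` of a multi-index. -/
noncomputable def multinomialWeight (y : Fin n → ℝ) (K : Fin n →₀ ℕ) : ℝ :=
  monomialEval y K / Nat.multinomial Finset.univ K

theorem monomialEval_pos {y : Fin n → ℝ} (hy : ∀ i, 0 < y i) (K : Fin n →₀ ℕ) :
    0 < monomialEval y K :=
  Finset.prod_pos fun i _ => pow_pos (hy i) _

theorem multinomialWeight_pos {y : Fin n → ℝ} (hy : ∀ i, 0 < y i) (K : Fin n →₀ ℕ) :
    0 < multinomialWeight y K :=
  div_pos (monomialEval_pos hy K) (by exact_mod_cast Nat.multinomial_pos _ _)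

theorem multinomialWeight_add_le {y : Fin n → ℝ} (hy : ∀ i, 0 < y i) (K L : Fin n →₀ ℕ) :
    multinomialWeight y (K + L) ≤ multinomialWeight y K * multinomialWeight y L := by
  have hK : (0 : ℝ) < Nat.multinomial Finset.univ K := by exact_mod_cast Nat.multinomial_pos _ _
  have hL : (0 : ℝ) < Nat.multinomial Finset.univ L := by exact_mod_cast Nat.multinomial_pos _ _
  unfold multinomialWeight
  rw [div_mul_div_comm, ← monomialEval_add]
  refine div_le_div_of_nonneg_left (monomialEval_pos hy _).le (mul_pos hK hL) ?_
  exact_mod_cast multinomial_mul_multinomial_le Finset.univ K L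

theorem multinomialWeight_le (y : Fin n → ℝ) (hy : ∀ i, 0 < y i) (K : Fin n →₀ ℕ) :
    multinomialWeight y K ≤ monomialEval y K :=
  div_le_self (monomialEval_pos hy K).le (by exact_mod_cast Nat.multinomial_pos _ _)

/-- A multinomial coefficient of total `|K|` is at most `2^(n |K|)`. So finite weighted norm forces
ordinary convergence on a smaller polydisc. -/
theorem pow_degree_le_multinomialWeight {y : Fin n → ℝ} {t : ℝ} (ht : 0 ≤ t)
    (hy : ∀ i, 2 ^ n * t ≤ y i) (K : Fin n →₀ ℕ) : t ^ K.degree ≤ multinomialWeight y K := by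
  have hK : (0 : ℝ) < Nat.multinomial Finset.univ K := by exact_mod_cast Nat.multinomial_pos _ _
  rw [multinomialWeight, le_div_iff₀ hK]
  have h1 : (Nat.multinomial Finset.univ K : ℝ) ≤ (2 ^ n) ^ K.degree := by
    have := multinomial_le_two_pow Finset.univ K (Finsupp.degree_eq_sum K).ge
    rw [Finset.card_univ, Fintype.card_fin, pow_right_comm] at this
    exact_mod_cast this
  calc t ^ K.degree * Nat.multinomial Finset.univ K ≤ t ^ K.degree * (2 ^ n) ^ K.degree := by
        gcongr
    _ = monomialEval (fun _ => 2 ^ n * t) K := by rw [monomialEval_const, mul_pow, mul_comm]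
    _ ≤ monomialEval y K := Finset.prod_le_prod (fun _ _ => by positivity) fun i _ =>
        pow_le_pow_left₀ (by positivity) (hy i) _

theorem multiFactorial_mul_multinomialWeight (y : Fin n → ℝ) (K : Fin n →₀ ℕ) :
    multiFactorial K * multinomialWeight y K * K.degree.factorial =
      multiFactorial K * multiFactorial K * monomialEval y K := by
  have hK : (0 : ℝ) < Nat.multinomial Finset.univ K := by exact_mod_cast Nat.multinomial_pos _ _
  have h1 : (multiFactorial K : ℝ) * Nat.multinomial Finset.univ K = K.degree.factorial := by
    rw [Finsupp.degree_eq_sum]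
    exact_mod_cast Nat.multinomial_spec Finset.univ K
  rw [multinomialWeight, ← h1]
  field_simp

/-- For these weights `K! w_Q / (Q! w_K)` equals `(y^Q / y^K) · |K|!/|Q|!`. The first factor is `y^J
/ y^I`, and `|I| ≤ |J|` forces `|K| ≤ |Q|`, so the second is at most 1. -/
theorem multiFactorial_mul_multinomialWeight_le {y : Fin n → ℝ} (hy : ∀ i, 0 < y i)
    {I J K Q : Fin n →₀ ℕ} (hIJ : I.degree ≤ J.degree) (h : Q + I = K + J) :
    multiFactorial K * multinomialWeight y Q ≤
      monomialEval y J / monomialEval y I * (multiFactorial Q * multinomialWeight y K) := by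
  have hfac : ∀ L : Fin n →₀ ℕ, multinomialWeight y L =
      multiFactorial L * monomialEval y L / L.degree.factorial := by
    intro L
    have hL : (0 : ℝ) < multiFactorial L := by exact_mod_cast multiFactorial_pos L
    have := multiFactorial_mul_multinomialWeight y L
    rw [eq_div_iff (by positivity)]
    refine mul_left_cancel₀ hL.ne' ?_
    linarith
  have hm : monomialEval y Q = monomialEval y K * monomialEval y J / monomialEval y I := by
    rw [eq_div_iff (monomialEval_pos hy I).ne', ← monomialEval_add, ← monomialEval_add, h]
  have hdeg : K.degree ≤ Q.degree := by
    have := congrArg Finsupp.degree h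
    simp only [map_add] at this
    omega
  have hpos : 0 ≤ monomialEval y J / monomialEval y I * (multiFactorial Q * multiFactorial K *
      monomialEval y K) := by
    have h1 := monomialEval_pos hy I
    have h2 := monomialEval_pos hy J
    have h3 := monomialEval_pos hy K
    positivity
  rw [hfac Q, hfac K, hm]
  calc _ = monomialEval y J / monomialEval y I * (multiFactorial Q * multiFactorial K *
      monomialEval y K) / Q.degree.factorial := by ring
    _ ≤ monomialEval y J / monomialEval y I * (multiFactorial Q * multiFactorial K *
      monomialEval y K) / K.degree.factorial := by
        refine div_le_div_of_nonneg_left hpos (by positivity) ?_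
        exact_mod_cast Nat.factorial_le hdeg
    _ = _ := by ring

/-- For `K ≠ 0` the weight is at most `R^|K| ≤ (R/t) t^|K|`. Hence, as `R → 0`, only the constant
coefficient remains in the bound. -/
theorem weightedNorm_multinomialWeight_le {y : Fin n → ℝ} (hy : ∀ i, 0 < y i) {R t : ℝ}
    (hyR : ∀ i, y i ≤ R) (ht : 0 < t) (hR : 0 < R) (hRt : R ≤ t) {b : MvPowerSeries (Fin n) ℝ}
    (hb : Summable fun K => |coeff K b| * t ^ K.degree) :
    weightedNorm (multinomialWeight y) b ≤
      ENNReal.ofReal (|coeff 0 b| + R * ((∑' K, |coeff K b| * t ^ K.degree) / t)) := by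
  have hterm : ∀ K, ‖coeff K b‖ₑ * ENNReal.ofReal (multinomialWeight y K) ≤
      ENNReal.ofReal ((if K = 0 then |coeff 0 b| else 0) +
        R / t * (|coeff K b| * t ^ K.degree)) := by
    intro K
    rw [Real.enorm_eq_ofReal_abs, ← ENNReal.ofReal_mul (abs_nonneg _)]
    refine ENNReal.ofReal_le_ofReal ?_
    have hw : multinomialWeight y K ≤ R ^ K.degree := by
      refine (multinomialWeight_le y hy K).trans ?_
      rw [← monomialEval_const]
      exact Finset.prod_le_prod (fun i _ => pow_nonneg (hy i).le _) fun i _ =>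
        pow_le_pow_left₀ (hy i).le (hyR i) _
    split_ifs with h
    · subst h
      have : multinomialWeight y 0 ≤ 1 := by simpa using hw
      have h2 : 0 ≤ R / t * (|coeff 0 b| * t ^ (0 : Fin n →₀ ℕ).degree) := by positivity
      nlinarith [abs_nonneg (coeff (0 : Fin n →₀ ℕ) b)]
    · have hdeg : K.degree ≠ 0 := fun h' => h ((Finsupp.degree_eq_zero_iff K).1 h')
      obtain ⟨m, hm⟩ := Nat.exists_eq_succ_of_ne_zero hdeg
      have h1 : R ^ K.degree ≤ R / t * t ^ K.degree := by
        rw [hm, pow_succ', pow_succ', ← mul_assoc, div_mul_cancel₀ _ ht.ne']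
        gcongr
      calc |coeff K b| * multinomialWeight y K ≤ |coeff K b| * (R / t * t ^ K.degree) := by
            gcongr
            exact hw.trans h1
        _ = 0 + R / t * (|coeff K b| * t ^ K.degree) := by ring
  have h1 : HasSum (fun K : Fin n →₀ ℕ => if K = 0 then |coeff 0 b| else 0) |coeff 0 b| :=
    hasSum_ite_eq 0 _
  have h2 := h1.add (hb.hasSum.mul_left (R / t))
  refine (ENNReal.tsum_le_tsum hterm).trans_eq ?_
  rw [← ENNReal.ofReal_tsum_of_nonneg _ h2.summable, h2.tsum_eq]
  · congr 1
    ring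
  · intro K
    split_ifs <;> positivity

/-- Polyradii for which the term `∂^J` dominates the other terms of a linear differential
operator. -/
theorem exists_polyradius {J : Fin n →₀ ℕ} {S : Finset (Fin n →₀ ℕ)}
    (β : (Fin n →₀ ℕ) → MvPowerSeries (Fin n) ℝ) {t : ℝ} (ht : 0 < t)
    (hβ : ∀ I ∈ S, Summable fun K => |coeff K (β I)| * t ^ K.degree)
    (hS : ∀ I ∈ S, I.degree ≤ J.degree)
    (hJ : ∀ I ∈ S, I.degree = J.degree → coeff 0 (β I) ≠ 0 →
      ∑ i, J i * I i < ∑ i, J i * J i) :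
    ∃ y : Fin n → ℝ, (∀ i, 0 < y i) ∧
      (∀ I ∈ S, weightedNorm (multinomialWeight y) (β I) ≠ ⊤) ∧
      ∑ I ∈ S, weightedNorm (multinomialWeight y) (β I) *
        ENNReal.ofReal (monomialEval y J / monomialEval y I) < 1 := by
  set B : ℝ := ∑ I ∈ S, |coeff 0 (β I)| with hB
  have hB0 : 0 ≤ B := Finset.sum_nonneg fun _ _ => abs_nonneg _
  set ρ : ℝ := (B + 1)⁻¹ with hρ
  have hρ0 : 0 < ρ := by positivity
  have hρ1 : ρ ≤ 1 := inv_le_one_of_one_le₀ (by linarith)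
  set A : (Fin n →₀ ℕ) → ℝ := fun I => (∑' K, |coeff K (β I)| * t ^ K.degree) / t
  set E : (Fin n →₀ ℕ) → ℝ := fun I => ρ ^ (∑ i, J i * J i) / ρ ^ (∑ i, J i * I i)
  -- `κ R` bounds the contraction constant for `y_i = R ρ^{J_i}`. At `R = 0` only terms of top order
  -- with nonzero constant coefficient survive; each carries at least one factor `ρ`, so `κ 0 ≤ B /
  -- (B + 1) < 1`, and continuity gives a positive `R`.
  set κ : ℝ → ℝ := fun R => ∑ I ∈ S,
    (|coeff 0 (β I)| + R * A I) * (R ^ (J.degree - I.degree) * E I) with hκ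
  have hκ0 : κ 0 < 1 := by
    have h1 : κ 0 ≤ ∑ I ∈ S, |coeff 0 (β I)| * ρ := by
      refine Finset.sum_le_sum fun I hI => ?_
      rw [zero_mul, add_zero]
      rcases (hS I hI).lt_or_eq with hlt | heq
      · rw [zero_pow (by omega), zero_mul, mul_zero]
        positivity
      · rcases eq_or_ne (coeff 0 (β I)) 0 with h0 | h0
        · simp [h0]
        · refine mul_le_mul_of_nonneg_left ?_ (abs_nonneg _)
          rw [heq, Nat.sub_self, pow_zero, one_mul, div_le_iff₀ (by positivity), ← pow_succ']
          exact pow_le_pow_of_le_one hρ0.le hρ1 (hJ I hI heq h0)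
    refine h1.trans_lt ?_
    rw [← Finset.sum_mul, hρ, ← div_eq_mul_inv, div_lt_one (by positivity)]
    linarith
  have hcont : Continuous κ := by fun_prop
  obtain ⟨R, hκR, hR0, hRt⟩ : ∃ R, κ R < 1 ∧ 0 < R ∧ R ≤ t := by
    have h1 : ∀ᶠ R in nhdsWithin 0 (Set.Ioi 0), κ R < 1 :=
      (hcont.continuousAt.eventually (gt_mem_nhds hκ0)).filter_mono nhdsWithin_le_nhds
    have h2 : ∀ᶠ R in nhdsWithin (0 : ℝ) (Set.Ioi 0), R ∈ Set.Ioc 0 t := Ioc_mem_nhdsGT ht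
    obtain ⟨R, h3, h4⟩ := (h1.and h2).exists
    exact ⟨R, h3, h4.1, h4.2⟩
  set y : Fin n → ℝ := fun i => R * ρ ^ J i with hy
  have hy0 : ∀ i, 0 < y i := fun i => by positivity
  have hyR : ∀ i, y i ≤ R := fun i =>
    mul_le_of_le_one_right hR0.le (pow_le_one₀ hρ0.le hρ1)
  have hmon : ∀ K : Fin n →₀ ℕ, monomialEval y K = R ^ K.degree * ρ ^ (∑ i, J i * K i) := by
    intro K
    simp only [monomialEval, hy, mul_pow, Finset.prod_mul_distrib, ← pow_mul]
    rw [Finset.prod_pow_eq_pow_sum, Finset.prod_pow_eq_pow_sum, Finsupp.degree_eq_sum]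
  have hratio : ∀ I ∈ S, monomialEval y J / monomialEval y I =
      R ^ (J.degree - I.degree) * E I := by
    intro I hI
    have h1 : R ^ J.degree = R ^ (J.degree - I.degree) * R ^ I.degree := by
      rw [← pow_add, Nat.sub_add_cancel (hS I hI)]
    rw [hmon, hmon, h1]
    simp only [E]
    field_simp
  have hnorm := fun I (hI : I ∈ S) =>
    weightedNorm_multinomialWeight_le hy0 hyR ht hR0 hRt (hβ I hI)
  refine ⟨y, hy0, fun I hI => ne_top_of_le_ne_top ENNReal.ofReal_ne_top (hnorm I hI), ?_⟩
  have hA : ∀ I, 0 ≤ A I := fun I => div_nonneg (tsum_nonneg fun K => by positivity) ht.le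
  refine lt_of_le_of_lt ?_ (ENNReal.ofReal_lt_one.2 hκR)
  rw [hκ, ENNReal.ofReal_sum_of_nonneg]
  · refine Finset.sum_le_sum fun I hI => ?_
    rw [hratio I hI, ENNReal.ofReal_mul (add_nonneg (abs_nonneg _) (mul_nonneg hR0.le (hA I)))]
    exact mul_le_mul_left (hnorm I hI) _
  · intro I _
    have := hA I
    positivity

end weights

/-! ### Local analytic solutions of linear equations. -/

section solution

open MvPowerSeries

variable {n : ℕ}

/-- A linear homogeneous differential equation of positive order with analytic coefficients has
near every point where the order does not drop an analytic solution without zeros. -/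
theorem exists_analytic_solution_ne_zero {s : ℕ} (hs : 1 ≤ s) {x₀ : Fin n → ℝ}
    {c : (Fin n →₀ ℕ) → (Fin n → ℝ) → ℝ} (hc : ∀ K, K.degree ≤ s → AnalyticAt ℝ (c K) x₀)
    (hne : ∃ K : Fin n →₀ ℕ, K.degree = s ∧ c K x₀ ≠ 0) :
    ∃ r > 0, ∃ ψ : (Fin n → ℝ) → ℝ, AnalyticOnNhd ℝ ψ (Metric.ball x₀ r) ∧
      ∀ x ∈ Metric.ball x₀ r, ψ x ≠ 0 ∧
        ∑ K ∈ multiIndicesLE n s, c K x * multiIter pderivX K ψ x = 0 := by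
  classical
  -- Maximal Euclidean length makes `J` an extreme point: `J·I < J·J` for the other top-order
  -- indices whose coefficient is nonzero at `x₀`.
  obtain ⟨J, hJmem, hJmax⟩ := ((multiIndicesLE n s).filter
    fun K => K.degree = s ∧ c K x₀ ≠ 0).exists_max_image (fun K => ∑ i, K i * K i) (by
      obtain ⟨K, hK⟩ := hne
      exact ⟨K, by simp [hK]⟩)
  simp only [Finset.mem_filter, mem_multiIndicesLE] at hJmem hJmax
  obtain ⟨-, hJs, hJ0⟩ := hJmem
  have hJne : J ≠ 0 := by
    rintro rfl
    simp at hJs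
    omega
  set S := (multiIndicesLE n s).erase J with hS
  have hSs : ∀ I ∈ S, I.degree ≤ s := fun I hI => by simpa using Finset.mem_of_mem_erase hI
  have hser : ∀ I : Fin n →₀ ℕ, ∃ b : MvPowerSeries (Fin n) ℝ, I ∈ S →
      ∃ r > 0, HasMvSeries (fun x => c I x / c J x) b x₀ r := by
    intro I
    by_cases hI : I ∈ S
    · obtain ⟨r, hr, b, hb⟩ := AnalyticAt.exists_hasMvSeries
        ((hc I (hSs I hI)).div (hc J hJs.le) hJ0)
      exact ⟨b, fun _ => ⟨r, hr, hb⟩⟩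
    · exact ⟨0, fun h => absurd h hI⟩
  choose β hβ using hser
  obtain ⟨r, hr, hβr⟩ : ∃ r > 0, ∀ I ∈ S, HasMvSeries (fun x => c I x / c J x) (β I) x₀ r := by
    have h1 : ∀ᶠ r in nhdsWithin (0 : ℝ) (Set.Ioi 0), ∀ I ∈ S,
        HasMvSeries (fun x => c I x / c J x) (β I) x₀ r := by
      rw [Filter.eventually_all_finset]
      intro I hI
      obtain ⟨r, hr, h⟩ := hβ I hI
      filter_upwards [Ioc_mem_nhdsGT hr] with r' hr' using h.mono hr'.2
    obtain ⟨r, h2, h3⟩ := (h1.and self_mem_nhdsWithin).exists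
    exact ⟨r, h3, h2⟩
  obtain ⟨y, hy, hβy, hsmall⟩ := exists_polyradius (J := J) (S := S) β (half_pos hr)
    (fun I hI => (hβr I hI).summable_abs (half_pos hr).le (half_lt_self hr))
    (fun I hI => (hSs I hI).trans_eq hJs.symm) (by
      intro I hI hIJ hI0
      have hcI : c I x₀ ≠ 0 := by
        rw [← (hβr I hI).apply_center hr] at hI0
        exact fun h => hI0 (by simp [h])
      have h1 := hJmax I ⟨hSs I hI, hIJ.trans hJs, hcI⟩
      obtain ⟨i, hi⟩ := Finsupp.ne_iff.1 (Finset.ne_of_mem_erase hI)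
      -- `|J - I|² > 0` gives `2 J·I < J·J + I·I ≤ 2 J·J`. Integers are used because the difference
      -- may be negative.
      have h2 : ∑ i, (2 * ((J i : ℤ) * I i)) < ∑ i, ((J i : ℤ) * J i + I i * I i) := by
        refine Finset.sum_lt_sum (fun j _ => ?_) ⟨i, Finset.mem_univ i, ?_⟩
        · nlinarith [sq_nonneg ((J j : ℤ) - I j)]
        · have h3 : (J i : ℤ) - I i ≠ 0 := by
            rw [sub_ne_zero]
            exact_mod_cast hi.symm
          nlinarith [sq_pos_of_ne_zero h3]
      rw [← Finset.mul_sum, Finset.sum_add_distrib] at h2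
      norm_cast at h2
      omega)
  have h0S : (0 : Fin n →₀ ℕ) ∈ S := Finset.mem_erase.2 ⟨hJne.symm, by simp⟩
  obtain ⟨v, hv0, hvn, hv⟩ := exists_formal_solution (multinomialWeight_pos hy)
    (multinomialWeight_add_le hy) hJne h0S β
    (C := fun I => monomialEval y J / monomialEval y I)
    (fun I _ => (div_pos (monomialEval_pos hy J) (monomialEval_pos hy I)).le)
    (fun I hI K Q h => multiFactorial_mul_multinomialWeight_le hy
      ((hSs I hI).trans_eq hJs.symm) h) (hβy 0 h0S) hsmall
  obtain ⟨t, ht, hty⟩ : ∃ t > 0, ∀ i, 2 ^ n * t ≤ y i := by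
    have h1 : ∀ᶠ t in nhdsWithin (0 : ℝ) (Set.Ioi 0), ∀ i, 2 ^ n * t ≤ y i := by
      rw [Filter.eventually_all]
      intro i
      have h2 : 0 < y i / 2 ^ n := div_pos (hy i) (by positivity)
      filter_upwards [Ioc_mem_nhdsGT h2] with t ht
      have := ht.2
      rw [le_div_iff₀ (by positivity)] at this
      linarith
    obtain ⟨t, h2, h3⟩ := (h1.and self_mem_nhdsWithin).exists
    exact ⟨t, h3, h2⟩
  have hvsum : Summable fun K => |coeff K v| * t ^ K.degree := by
    have h1 := ENNReal.summable_toReal hvn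
    refine Summable.of_nonneg_of_le (fun K => by positivity) (fun K => ?_) h1
    rw [ENNReal.toReal_mul, toReal_enorm, ENNReal.toReal_ofReal (multinomialWeight_pos hy K).le]
    exact mul_le_mul_of_nonneg_left (pow_degree_le_multinomialWeight ht.le hty K) (abs_nonneg _)
  set ψ : (Fin n → ℝ) → ℝ := fun x => ∑' K, coeff K v * monomialEval (x - x₀) K
  have hψ : HasMvSeries ψ v x₀ t := HasMvSeries.of_summable hvsum
  have hψa : AnalyticOnNhd ℝ ψ (Metric.ball x₀ t) := hψ.analyticOnNhd ht
  have hψ0 : ψ x₀ ≠ 0 := by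
    rw [hψ.apply_center ht, hv0]
    exact one_ne_zero
  have hPDE : ∀ x ∈ Metric.ball x₀ (min r t), multiIter pderivX J ψ x +
      ∑ I ∈ S, c I x / c J x * multiIter pderivX I ψ x = 0 := by
    have h1 := (hψ.multiIter_pderivX J).mono (min_le_right r t)
    have h2 := HasMvSeries.sum S fun I hI =>
      ((hβr I hI).mono (min_le_left r t)).mul
        ((hψ.multiIter_pderivX I).mono (min_le_right r t))
    have h3 := h1.add h2
    rw [hv] at h3
    exact fun x hx => h3.eq_zero hx
  have hev : ∀ᶠ x in nhds x₀, ψ x ≠ 0 ∧ c J x ≠ 0 :=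
    ((hψa x₀ (Metric.mem_ball_self ht)).continuousAt.eventually_ne hψ0).and
      ((hc J hJs.le).continuousAt.eventually_ne hJ0)
  obtain ⟨q, hq, hqball⟩ := Metric.eventually_nhds_iff_ball.1 hev
  refine ⟨min q (min r t), lt_min hq (lt_min hr ht), ψ, hψa.mono (Metric.ball_subset_ball
    ((min_le_right _ _).trans (min_le_right _ _))), fun x hx => ?_⟩
  obtain ⟨hψx, hcx⟩ := hqball x (Metric.ball_subset_ball (min_le_left _ _) hx)
  refine ⟨hψx, ?_⟩
  have h1 := hPDE x (Metric.ball_subset_ball (min_le_right _ _) hx)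
  rw [← Finset.add_sum_erase _ _ (show J ∈ multiIndicesLE n s by simp [hJs])]
  have h2 := congrArg (c J x * ·) h1
  simp only [mul_add, Finset.mul_sum, mul_zero] at h2
  rw [← h2]
  congr 1
  refine Finset.sum_congr rfl fun I _ => ?_
  field_simp

end solution

/-! ### Assembly of the three statements. -/

theorem proposition3p2 {n : ℕ} (s : ℕ) (Ω : Set (Fin n → ℝ)) (hΩ : IsOpen Ω)
    (a : (Fin n →₀ ℕ) → (Fin n → ℝ) → ℝ) (f : (Fin n → ℝ) → ℝ)
    (ha : ∀ I, I.degree ≤ s → AnalyticOnNhd ℝ (a I) Ω) (hf : AnalyticOnNhd ℝ f Ω)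
    -- the equation has order `s`
    (hs : ∃ x ∈ Ω, ∃ I : Fin n →₀ ℕ, I.degree = s ∧ a I x ≠ 0) :
    -- the adjoint equation does not involve `u`
    (∀ x ∈ Ω, ∀ w w' : (Unit ⊕ Unit) × (Fin n →₀ ℕ) → ℝ,
      (∀ I, w (Sum.inr (), I) = w' (Sum.inr (), I)) →
        adjointSystem (linearEquation s a f) () (x, w) =
          adjointSystem (linearEquation s a f) () (x, w')) ∧
    -- every nonzero solution `v = ψ(x)` of the adjoint equation is an admissible substitution
    (∀ U : Set (Fin n → ℝ), IsOpen U → IsConnected U → U ⊆ Ω → ∀ ψ : (Fin n → ℝ) → ℝ,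
      AnalyticOnNhd ℝ ψ U → (∃ x ∈ U, ψ x ≠ 0) →
      (∀ x ∈ U, adjointSystem (linearEquation s a f) ()
        (jetOf (Sum.elim (fun _ _ => 0) fun _ => ψ) x) = 0) →
      IsNonlinearlySelfAdjointVia U (linearEquation s a f) (fun _ p => ψ p.1) ∧
        IsNonlinearlySelfAdjointViaSolutions U (linearEquation s a f) (fun _ p => ψ p.1)) ∧
    -- the equation is nonlinearly self-adjoint near every point where its order is `s`;
    -- if `s ≥ 1`, with a substitution `v = ψ(x)` that vanishes nowhere
    (∀ x₀ ∈ Ω, (∃ I : Fin n →₀ ℕ, I.degree = s ∧ a I x₀ ≠ 0) →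
      ∃ U : Set (Fin n → ℝ), x₀ ∈ U ∧ U ⊆ Ω ∧
        ∃ φ : Unit → (Fin n → ℝ) × (Unit → ℝ) → ℝ,
          IsNonlinearlySelfAdjointVia U (linearEquation s a f) φ ∧
          IsNonlinearlySelfAdjointViaSolutions U (linearEquation s a f) φ ∧
          (1 ≤ s → ∃ ψ : (Fin n → ℝ) → ℝ,
            (∀ x ∈ U, ψ x ≠ 0) ∧ ∀ p, φ () p = ψ p.1)) := by
  refine ⟨fun x hx w w' h => adjointSystem_linearEquation_congr s hΩ a f ha hx h,
    fun U hU hUc hUΩ ψ hψ hne hsol =>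
      isNonlinearlySelfAdjoint_of_adjoint_solution s hΩ a f ha hU hUc hUΩ hψ hne hsol,
    fun x₀ hx₀ hI => ?_⟩
  obtain ⟨δ, hδ, hδΩ⟩ := Metric.isOpen_iff.1 hΩ x₀ hx₀
  have hball : ∀ {r : ℝ}, 0 < r → IsConnected (Metric.ball x₀ r) := fun {r} hr =>
    (convex_ball x₀ r).isConnected ⟨x₀, Metric.mem_ball_self hr⟩
  -- Order zero is separate: near `x₀` the adjoint equation `a_0 v = 0` has only the zero solution,
  -- so the substitution must involve `u`.
  rcases Nat.eq_zero_or_pos s with rfl | hs1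
  · obtain ⟨I, hI0, hIa⟩ := hI
    obtain rfl := (Finsupp.degree_eq_zero_iff I).1 hI0
    have h := isNonlinearlySelfAdjoint_of_order_zero hΩ a f (ha 0 (by simp))
      Metric.isOpen_ball (hball hδ) hδΩ (hf.mono hδΩ) ⟨x₀, Metric.mem_ball_self hδ, hIa⟩
    exact ⟨_, Metric.mem_ball_self hδ, hδΩ, _, h.1, h.2, fun h => absurd h (by omega)⟩
  · obtain ⟨c, hca, hctop, hadj⟩ := exists_adjointSystem_linearEquation_eq_sum s hΩ a f ha
    obtain ⟨r, hr, ψ, hψ, hsol⟩ := exists_analytic_solution_ne_zero hs1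
      (fun K _ => hca K x₀ hx₀) (by
        obtain ⟨I, hIs, hIa⟩ := hI
        refine ⟨I, hIs, ?_⟩
        rw [hctop I hIs]
        exact mul_ne_zero (pow_ne_zero _ (by norm_num)) hIa)
    have hm : 0 < min r δ := lt_min hr hδ
    have hr' : Metric.ball x₀ (min r δ) ⊆ Metric.ball x₀ r :=
      Metric.ball_subset_ball (min_le_left _ _)
    have hUΩ : Metric.ball x₀ (min r δ) ⊆ Ω :=
      (Metric.ball_subset_ball (min_le_right _ _)).trans hδΩ
    have h := isNonlinearlySelfAdjoint_of_adjoint_solution s hΩ a f ha Metric.isOpen_ball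
      (hball hm) hUΩ (hψ.mono hr')
      ⟨x₀, Metric.mem_ball_self hm, (hsol x₀ (Metric.mem_ball_self hr)).1⟩
      (fun x hx => (hadj x (hUΩ hx) _).trans (hsol x (hr' hx)).2)
    exact ⟨_, Metric.mem_ball_self hm, hUΩ, _, h.1, h.2,
      fun _ => ⟨ψ, fun x hx => (hsol x (hr' hx)).1, fun _ => rfl⟩⟩
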